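/- **Setting.** All sequences are indexed by the integers $i\ge 1$. Write $\|x\|_1=\sum_i |x_i|$, $\|x\|_{1,1}=\sum_i i|x_i|$; let $\mathcal X_{1,m}$ be the space of real sequences with $\|x\|_{1,1}<\infty$ and $x_i=0$ for $i<m$, and $\mathcal X_{1,m}^+$ the subset of its elements with nonnegative components. *Kernel.* $K$ is a real function on pairs of positive integers such that, for some $\kappa>0$, $$0\le K(i,j)=K(j,i)\le \kappa\, i\,j\quad (i,j\ge 1),\qquad \delta_i:=\inf_{j\ge i}K(i,j)>0\quad (i\ge1),\tag{c1}$$ and there are $\kappa_i>0$ $(i\ge1)$ with $K(i,j)\le\kappa_i$ for all $j\ge i$ and $\sup_{i\ge1}\kappa_i/i<\infty$. *Deterministic equation.* For $i\ge 1$ let $b^{(i)}_j(x)=0$ for $j<i$, $b^{(i)}_i(x)=-2K(i,i)x_i-\sum_{j>i}K(i,j)x_j$, and $b^{(i)}_j(x)=K(j-i,i)x_{j-i}-K(i,j)x_j$ for $j>i$. Let $x_0\in\mathcal X_{1,1}^+$ with $x_{1,0}>0$ and $\|x_0\|_{1,1}=1$. The solution of the min-driven coagulation equation starting from $x_0$ is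 the pair $(\ell,x)$ such that there are times $0=t_0<t_1<t_2<\cdots$ with supremum $t_\infty\in(0,\infty]$ and $\ell(t)=i$ for $t\in[t_{i-1},t_i)$, $i\ge1$; $x\in\mathcal C([0,t_\infty);\mathcal X_{1,1})$; $x(0)=x_0$; $x(t)\in\mathcal X^+_{1,\ell(t)}\setminus\mathcal X_{1,\ell(t)+1}$ for $t\in[0,t_\infty)$; and $\frac{dx}{dt}(t)=b^{(\ell(t))}(x(t))$ for $t\in[0,t_\infty)\setminus\{t_i: i\ge0\}$. *Stochastic process.* A configuration is a summable sequence $X=(X_i)_{i\ge1}$ of nonnegative integers ($X_i$ is the number of particles of size $i$); its mass is $\sum_i iX_i$ and, if it is nonzero, its minimal size is $\ell_X=\min\{i: X_i>0\}$. The min-driven coagulation process is the right-continuous pure jump Markov process on configurations which jumps from $X$ to the configuration obtained by replacing one particle of size $\ell_X$ and another one of size $j\ge\ell_X$ by one particle of size $\ell_X+j$, at rate $K(\ell_X,j)X_j$ if $j>\ell_X$ and at rate $K(\ell_X,\ell_X)(X_{\ell_X}-1)$ if $j=\ell_X$. **Theorem.** Let $K$, $x_0$ and $(\ell,x)$, $t_\infty$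 be as above. For each $N\ge1$ let $X_0^N$ be a random configuration of mass $N$ such that $$\mathbb P\Big(\Big\|\tfrac1N X_0^N-x_0\Big\|_1>\tfrac1{N^{1/4}}\Big)\le\tfrac1{N^{1/4}},$$ and let $X^N=(X^N(s))_{s\ge0}$ be the min-driven coagulation process with kernel $K$ starting from $X_0^N$. Then for every $t\in(0,t_\infty)$ there are constants $C(t),D(t)>0$ such that, for all sufficiently large $N$, $$\mathbb P\Big(\sup_{0\le s\le t}\Big\|\tfrac1N X^N(s)-x(s)\Big\|_1\ge\tfrac{D(t)}{N^{1/4}}\Big)\le\tfrac{C(t)}{N^{1/4}}.$$ -/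

import Mathlib

open Filter Topology MeasureTheory
open scoped NNReal ENNReal

namespace MinDriven

noncomputable section

/-! ### Sequence spaces (sequences are indexed by the positive integers) -/

/-- The norm `‖x‖₁ = ∑ i, |x i|`, with value `∞` when the series diverges. -/
def l1Norm (x : ℕ+ → ℝ) : ℝ≥0∞ := ∑' i, ‖x i‖ₑ

/-- The norm `‖x‖₁,₁ = ∑ i, i |x i|`, with value `∞` when the series diverges. -/
def momentNorm (x : ℕ+ → ℝ) : ℝ≥0∞ := ∑' i : ℕ+, ((i : ℕ) : ℝ≥0∞) * ‖x i‖ₑ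

/-- The space `𝒳_{1,m}`: finite first moment, and the first `m - 1` components vanish. -/
def XSpace (m : ℕ+) : Set (ℕ+ → ℝ) :=
  {x | momentNorm x < ⊤ ∧ ∀ i, i < m → x i = 0}

/-- The positive cone `𝒳_{1,m}⁺`. -/
def XCone (m : ℕ+) : Set (ℕ+ → ℝ) :=
  {x | x ∈ XSpace m ∧ ∀ i, 0 ≤ x i}

/-! ### The coagulation kernel -/

/-- Standing assumptions on the coagulation kernel: for some `κ > 0`,
`0 ≤ K(i,j) = K(j,i) ≤ κ i j`, and `δ_i = inf_{j ≥ i} K(i,j) > 0` for every `i`. -/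
structure IsCoagulationKernel (K : ℕ+ → ℕ+ → ℝ) : Prop where
  nonneg : ∀ i j, 0 ≤ K i j
  symm : ∀ i j, K i j = K j i
  growth : ∃ κ : ℝ, 0 < κ ∧ ∀ i j : ℕ+, K i j ≤ κ * (i : ℕ) * (j : ℕ)
  inf_pos : ∀ i : ℕ+, 0 < ⨅ j : Set.Ici i, K i j

/-- `K(i,j) ≤ κ_i` for `j ≥ i`, where `κ_i > 0` and `sup_i κ_i / i < ∞`. -/
def HasMinBound (K : ℕ+ → ℕ+ → ℝ) : Prop :=
  ∃ κ : ℕ+ → ℝ, (∀ i, 0 < κ i) ∧ (∀ i j, i ≤ j → K i j ≤ κ i) ∧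
    BddAbove (Set.range fun i : ℕ+ => κ i / (i : ℕ))

/-! ### The deterministic min-driven coagulation equation -/

/-- The vector field `b^{(i)}`. -/
def drift (K : ℕ+ → ℕ+ → ℝ) (i : ℕ+) (x : ℕ+ → ℝ) (j : ℕ+) : ℝ :=
  if j < i then 0
  else if j = i then -2 * K i i * x i - ∑' k : Set.Ioi i, K i k * x k
  else K (j - i) i * x (j - i) - K i j * x j

/-- `t_∞ = sup_i t_i`. -/
def lifespan (τ : ℕ → ℝ) : EReal := ⨆ i, (τ i : EReal)

/-- The interval `[0, t_∞)`. -/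
def lifeInterval (τ : ℕ → ℝ) : Set ℝ := {t | 0 ≤ t ∧ (t : EReal) < lifespan τ}

/-- `(ℓ, x)` is the solution of the min-driven coagulation equation starting from `x₀`, with
jump times `τ 0 = 0 < τ 1 < τ 2 < ⋯` of the minimal size `ℓ`. Values of `ℓ` and `x` outside
`[0, t_∞)` are irrelevant. The differential equation is read component by component (as `x` is
continuous into `𝒳_{1,1}`, this is the same as reading it in `ℓ¹`). -/
structure IsSolution (K : ℕ+ → ℕ+ → ℝ) (x₀ : ℕ+ → ℝ) (τ : ℕ → ℝ) (ℓ : ℝ → ℕ+)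
    (x : ℝ → ℕ+ → ℝ) : Prop where
  time_zero : τ 0 = 0
  time_strictMono : StrictMono τ
  minSize_eq : ∀ i : ℕ, ∀ t ∈ Set.Ico (τ i) (τ (i + 1)), ℓ t = i.succPNat
  continuous : ∀ s ∈ lifeInterval τ,
    Tendsto (fun r => momentNorm (x r - x s)) (𝓝[lifeInterval τ] s) (𝓝 0)
  initial : x 0 = x₀
  mem : ∀ t ∈ lifeInterval τ, x t ∈ XCone (ℓ t) \ XSpace (ℓ t + 1)
  ode : ∀ t ∈ lifeInterval τ \ Set.range τ, ∀ j : ℕ+,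
    HasDerivAt (fun r => x r j) (drift K (ℓ t) (x t) j) t

/-! ### The stochastic min-driven coagulation process -/

/-- Particle configurations: `X i` is the number of particles of size `i`. A summable sequence of
natural numbers is the same thing as a finitely supported one. -/
abbrev Config : Type := ℕ+ →₀ ℕ

/-- The countable state space carries the discrete σ-algebra. -/
instance instMeasurableSpaceConfig : MeasurableSpace Config := ⊤

/-- Total mass `∑ i, i X_i`. -/
def mass (X : Config) : ℕ := X.sum fun i n => (i : ℕ) * n

/-- The minimal size `ℓ_X` of a configuration (`1` for the empty configuration). -/
def minSize (X : Config) : ℕ+ :=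
  if h : X.support.Nonempty then X.support.min' h else 1

/-- The configuration obtained from `X` by merging a particle of minimal size with another
particle, of size `j`. -/
def merge (X : Config) (j : ℕ+) : Config :=
  X - Finsupp.single (minSize X) 1 - Finsupp.single j 1 + Finsupp.single (minSize X + j) 1

/-- The rate of the jump from `X` to `merge X j`: it is `K(ℓ_X, j) X_j` for `j > ℓ_X` and
`K(ℓ_X, ℓ_X) (X_{ℓ_X} - 1)` for `j = ℓ_X`. -/
def mergeRate (K : ℕ+ → ℕ+ → ℝ) (X : Config) (j : ℕ+) : ℝ :=
  K (minSize X) j * ((X j : ℝ) - if j = minSize X then 1 else 0)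

/-- The configurations of total mass `M`. -/
abbrev Shell (M : ℕ) : Type := {X : Config // mass X = M}

lemma shell_finite (M : ℕ) : {X : Config | mass X = M}.Finite := by
  classical
  have hterm : ∀ (X : Config) (i : ℕ+), mass X = M → X i ≠ 0 → (i : ℕ) * X i ≤ M := by
    intro X i hX hi
    rw [← hX]
    exact Finset.single_le_sum (f := fun i : ℕ+ => (i : ℕ) * X i) (fun _ _ => Nat.zero_le _)
      (Finsupp.mem_support_iff.mpr hi)
  refine (Set.finite_Iic (Finsupp.onFinset (Finset.Iic M.succPNat)
    (fun i : ℕ+ => if i ≤ M.succPNat then M else 0) ?_ : Config)).subset ?_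
  · intro i hi
    by_contra h
    exact hi (if_neg (by simpa using h))
  · intro X hX i
    by_cases hi : X i = 0
    · simp [hi]
    · have h := hterm X i hX hi
      have h1 : (i : ℕ) ≤ M := (Nat.le_mul_of_pos_right _ (Nat.pos_of_ne_zero hi)).trans h
      have h2 : X i ≤ M := (Nat.le_mul_of_pos_left _ i.pos).trans h
      have h3 : i ≤ M.succPNat := by
        rw [← PNat.coe_le_coe, Nat.succPNat_coe]
        omega
      simpa [h3] using h2

instance instFintypeShell (M : ℕ) : Fintype (Shell M) := (shell_finite M).fintype

/-- The generator (matrix of jump rates, with minus the total jump rate on the diagonal) of the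
process on configurations of mass `M`; it acts on functions by
`(L f)(X) = ∑ j, mergeRate K X j * (f (merge X j) - f X)`. -/
def generator (K : ℕ+ → ℕ+ → ℝ) (M : ℕ) : Matrix (Shell M) (Shell M) ℝ := fun X Y =>
  ∑ j ∈ X.1.support, mergeRate K X.1 j *
    ((if Y.1 = merge X.1 j then 1 else 0) - if Y.1 = X.1 then 1 else 0)

/-- The σ-algebra generated by the process up to time `s`. -/
@[reducible] def past {Ω : Type*} (X : ℝ≥0 → Ω → Config) (s : ℝ≥0) : MeasurableSpace Ω :=
  ⨆ r ∈ Set.Iic s, MeasurableSpace.comap (X r) inferInstance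

/-- `X` is the stochastic min-driven coagulation process with kernel `K` starting from `X₀`: the
right-continuous pure jump Markov process with the jump rates `mergeRate K`. Jumps preserve the
mass, so that on each of the finite sets `Shell M` the transition probabilities over a time step
`h` are the entries of `exp (h • generator K M)`. -/
structure IsMinDrivenProcess {Ω : Type*} [MeasurableSpace Ω] (P : Measure Ω)
    (K : ℕ+ → ℕ+ → ℝ) (X₀ : Ω → Config) (X : ℝ≥0 → Ω → Config) : Prop where
  measurable : ∀ t, Measurable (X t)
  initial : ∀ᵐ ω ∂P, X 0 ω = X₀ ω
  rightContinuous : ∀ᵐ ω ∂P, ∀ t, ∀ᶠ s in 𝓝[>] t, X s ω = X t ω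
  markov : ∀ (s h : ℝ≥0) (A : Set Ω), MeasurableSet[past X s] A →
    ∀ (M : ℕ) (Y Z : Shell M),
      P.real (A ∩ {ω | X s ω = Y} ∩ {ω | X (s + h) ω = Z}) =
        P.real (A ∩ {ω | X s ω = Y}) * NormedSpace.exp ((h : ℝ) • generator K M) Y Z

/-- The renormalized configuration `X / N`. -/
def renorm (N : ℕ) (X : Config) : ℕ+ → ℝ := fun i => (X i : ℝ) / N

end

end MinDriven

/-!
The renormalized process is compared with the solution by a martingale estimate followed by a purely
deterministic stability estimate, with `ε = N ^ (-1 / 4)`.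

*Martingale part.* The process is observed at the times `k * h` only. As the mass is conserved, it
is then a Markov chain on a finite set, with transition matrix `exp (h • generator K N)`, and for
`h → 0` the compensators of its components follow `genDrift`, which is the vector field `drift` up
to `O(1 / N)`. Only the first `R ≈ N ^ (1 / 4)` components are followed, since the first moment
bounds the rest of the `ℓ¹`-norm by `1 / R`. The linear growth of the minimal interactions bounds
the total jump rate by a multiple of the mass `N`, whatever the minimal size, so that the squares of
the `R` martingales add up to `O(1 / N)` in mean. Doob's inequality
(`IsMarkovChain.maximal_ineq`) and the Cauchy-Schwarz inequality then bound their sum of absolute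
values by `ε`, outside an event of probability of order `R / (N * ε ^ 2) ≈ ε`.

*Deterministic part.* Outside this event the sampled path, extended as a step function, is an
approximate solution (`IsApproxSolution`) with errors of order `ε`. The vector field is Lipschitz in
`ℓ¹` as long as the two minimal sizes agree, and Grönwall's inequality applies. While they disagree,
the component which belongs to the smaller of the two minimal sizes is present in one of the
trajectories only, hence of order `ε` at the beginning of this period. It is depleted at a rate
bounded below, because of `δ_i > 0` and of the lower bound of the `ℓ¹`-norm of the solution on
compact time intervals. So the disagreement lasts for a time of order `ε`, and increases the
distance by `O(ε)` because the vector fields are bounded. An induction on the minimal size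
(`StageComparison.exists_bound_of_stage_le`) leads to `IsSolution.stability`.

*From grids to all times.* The events of a deviation on the dyadic grids increase, so that their
union obeys the same bound. By right-continuity this union contains the event of a deviation at some
time (`exists_mem_farOnGrid`).
-/

namespace MinDriven

/-! ### Doob's maximal inequality for finite Markov chains -/

section MarkovChain

variable {Ω S : Type*} [mΩ : MeasurableSpace Ω] [Fintype S] [MeasurableSpace S]
  [MeasurableSingletonClass S]

set_option linter.unusedSectionVars false

/-- The one-step expected increment of `f` under the transition matrix `Q`. -/
def meanIncr (Q : Matrix S S ℝ) (f : S → ℝ) (y : S) : ℝ := ∑ z, Q y z * (f z - f y)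

/-- `Y` is a Markov chain with respect to the filtration `ℱ`, with transition matrix `Q`. The Markov
property is stated without conditional probabilities, in product form. -/
structure IsMarkovChain (P : Measure Ω) (ℱ : Filtration ℕ mΩ) (Q : Matrix S S ℝ)
    (Y : ℕ → Ω → S) : Prop where
  adapted : ∀ k, Measurable[ℱ k] (Y k)
  step : ∀ k A, MeasurableSet[ℱ k] A → ∀ y z,
    P.real (A ∩ {ω | Y k ω = y} ∩ {ω | Y (k + 1) ω = z}) = P.real (A ∩ {ω | Y k ω = y}) * Q y z

/-- The martingale part of `f (Y k)` in Doob's decomposition. -/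
def martPart (Q : Matrix S S ℝ) (f : S → ℝ) (Y : ℕ → Ω → S) (k : ℕ) (ω : Ω) : ℝ :=
  f (Y k ω) - f (Y 0 ω) - ∑ l ∈ Finset.range k, meanIncr Q f (Y l ω)

lemma setIntegral_comp_fintype {P : Measure Ω} [IsFiniteMeasure P] {W : Ω → S}
    (hW : Measurable W) (g : S → ℝ) (A : Set Ω) :
    ∫ ω in A, g (W ω) ∂P = ∑ w, P.real (A ∩ {ω | W ω = w}) * g w := by
  have hg : Measurable g := measurable_of_finite g
  rw [← integral_map (φ := W) hW.aemeasurable hg.aestronglyMeasurable,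
    integral_fintype (Integrable.of_finite)]
  refine Finset.sum_congr rfl fun w _ => ?_
  rw [map_measureReal_apply hW (measurableSet_singleton w),
    measureReal_restrict_apply (hW (measurableSet_singleton w)), smul_eq_mul, Set.inter_comm]
  rfl

lemma integrable_comp_fintype {P : Measure Ω} [IsFiniteMeasure P] {W : Ω → S}
    (hW : Measurable W) (g : S → ℝ) : Integrable (fun ω => g (W ω)) P := by
  have : Integrable g (P.map W) := Integrable.of_finite
  exact this.comp_measurable hW

variable {P : Measure Ω} [IsProbabilityMeasure P] {ℱ : Filtration ℕ mΩ} {Q : Matrix S S ℝ}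
  {Y : ℕ → Ω → S}

namespace IsMarkovChain

lemma measurable (hY : IsMarkovChain P ℱ Q Y) (k : ℕ) : Measurable (Y k) :=
  (hY.adapted k).mono (ℱ.le k) le_rfl

lemma setIntegral_pair (hY : IsMarkovChain P ℱ Q Y) (g : S → S → ℝ) (k : ℕ) {A : Set Ω}
    (hA : MeasurableSet[ℱ k] A) :
    ∫ ω in A, g (Y k ω) (Y (k + 1) ω) ∂P = ∫ ω in A, ∑ z, Q (Y k ω) z * g (Y k ω) z ∂P := by
  have h1 := setIntegral_comp_fintype (P := P) ((hY.measurable k).prodMk (hY.measurable (k + 1)))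
    (fun w : S × S => g w.1 w.2) A
  have h2 := setIntegral_comp_fintype (P := P) (hY.measurable k)
    (fun y => ∑ z, Q y z * g y z) A
  simp only at h1 h2
  rw [h1, h2, Fintype.sum_prod_type]
  refine Finset.sum_congr rfl fun y _ => ?_
  rw [Finset.mul_sum]
  refine Finset.sum_congr rfl fun z _ => ?_
  rw [← mul_assoc, ← hY.step k A hA y z, Set.inter_assoc]
  congr 3
  ext ω
  simp [Prod.ext_iff]

lemma adapted_martPart (hY : IsMarkovChain P ℱ Q Y) (f : S → ℝ) (k : ℕ) :
    Measurable[ℱ k] (martPart Q f Y k) := by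
  have hc : ∀ (g : S → ℝ) (l : ℕ), l ≤ k → Measurable[ℱ k] fun ω => g (Y l ω) := fun g l hl =>
    (measurable_of_finite g).comp ((hY.adapted l).mono (ℱ.mono hl) le_rfl)
  unfold martPart
  refine ((hc f k le_rfl).sub (hc f 0 (Nat.zero_le _))).sub ?_
  exact Finset.measurable_sum _ fun l hl => hc _ l (Finset.mem_range.1 hl).le

lemma exists_bound_martPart (f : S → ℝ) (k : ℕ) :
    ∃ C, ∀ ω, |martPart Q f Y k ω| ≤ C := by
  obtain ⟨a, ha⟩ : ∃ a, ∀ y, |f y| ≤ a := by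
    simpa [bddAbove_def] using (Set.finite_range fun y => |f y|).bddAbove
  obtain ⟨b, hb⟩ : ∃ b, ∀ y, |meanIncr Q f y| ≤ b := by
    simpa [bddAbove_def] using (Set.finite_range fun y => |meanIncr Q f y|).bddAbove
  refine ⟨a + a + k * b, fun ω => ?_⟩
  unfold martPart
  refine (abs_sub _ _).trans (add_le_add ((abs_sub _ _).trans (add_le_add (ha _) (ha _))) ?_)
  refine (Finset.abs_sum_le_sum_abs _ _).trans ((Finset.sum_le_sum fun l _ => hb _).trans ?_)
  simp

lemma martPart_succ (f : S → ℝ) (k : ℕ) (ω : Ω) :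
    martPart Q f Y (k + 1) ω =
      martPart Q f Y k ω + (f (Y (k + 1) ω) - f (Y k ω) - meanIncr Q f (Y k ω)) := by
  simp only [martPart, Finset.sum_range_succ]
  ring

/-- The increments of the martingale part are orthogonal to bounded functions of the past. -/
lemma integral_mul_incr (hY : IsMarkovChain P ℱ Q Y) (f : S → ℝ) (k : ℕ) {G : Ω → ℝ}
    (hG : Measurable[ℱ k] G) (hGb : ∃ C, ∀ ω, |G ω| ≤ C) :
    ∫ ω, G ω * (f (Y (k + 1) ω) - f (Y k ω) - meanIncr Q f (Y k ω)) ∂P = 0 := by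
  set Δ : Ω → ℝ := fun ω => f (Y (k + 1) ω) - f (Y k ω) - meanIncr Q f (Y k ω) with hΔ
  obtain ⟨C, hC⟩ := hGb
  have hm := hY.measurable
  have hD : Integrable (fun ω => f (Y (k + 1) ω) - f (Y k ω)) P :=
    (integrable_comp_fintype (hm _) f).sub (integrable_comp_fintype (hm _) f)
  have hE : Integrable (fun ω => meanIncr Q f (Y k ω)) P := integrable_comp_fintype (hm _) _
  have hint : Integrable Δ P := hD.sub hE
  have hzero : ∀ A, MeasurableSet[ℱ k] A → ∫ ω in A, Δ ω ∂P = 0 := by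
    intro A hA
    have h1 : ∫ ω in A, Δ ω ∂P = ∫ ω in A, (f (Y (k + 1) ω) - f (Y k ω)) ∂P -
        ∫ ω in A, meanIncr Q f (Y k ω) ∂P := integral_sub hD.integrableOn hE.integrableOn
    rw [h1, hY.setIntegral_pair (fun y z => f z - f y) k hA]
    simp [meanIncr]
  have hcond : (fun _ => (0 : ℝ)) =ᵐ[P] P[Δ|ℱ k] := by
    refine ae_eq_condExp_of_forall_setIntegral_eq (ℱ.le k) hint (fun _ _ _ => integrableOn_zero)
      ?_ ?_
    · intro A hA _
      simp [hzero A hA]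
    · exact aestronglyMeasurable_const
  have hGΔ : Integrable (G * Δ) P :=
    hint.bdd_mul (c := C) (hG.mono (ℱ.le k) le_rfl).aestronglyMeasurable
      (Eventually.of_forall fun ω => by simpa using hC ω)
  have hpull := condExp_mul_of_stronglyMeasurable_left (μ := P) hG.stronglyMeasurable hGΔ hint
  change ∫ ω, (G * Δ) ω ∂P = 0
  rw [← integral_condExp (ℱ.le k), integral_congr_ae hpull]
  rw [integral_congr_ae (g := fun _ => (0 : ℝ)), integral_zero]
  filter_upwards [hcond] with ω hω
  simp [← hω]

/-- The variance of an increment of the martingale part is at most the second moment of the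
corresponding increment of the chain. -/
lemma integral_incr_sq_le (hY : IsMarkovChain P ℱ Q Y) (f : S → ℝ) (k : ℕ) :
    ∫ ω, (f (Y (k + 1) ω) - f (Y k ω) - meanIncr Q f (Y k ω)) ^ 2 ∂P ≤
      ∫ ω, ∑ z, Q (Y k ω) z * (f z - f (Y k ω)) ^ 2 ∂P := by
  have hm := hY.measurable
  have hpair := hY.setIntegral_pair (fun y z => (f z - f y) ^ 2) k MeasurableSet.univ
  simp only [setIntegral_univ] at hpair
  rw [← hpair]
  obtain ⟨b, hb⟩ : ∃ b, ∀ y, |meanIncr Q f y| ≤ b := by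
    simpa [bddAbove_def] using (Set.finite_range fun y => |meanIncr Q f y|).bddAbove
  have horth := hY.integral_mul_incr f k (G := fun ω => meanIncr Q f (Y k ω))
    ((measurable_of_finite (meanIncr Q f)).comp (hY.adapted k)) ⟨b, fun ω => hb _⟩
  have hip : ∀ g : S × S → ℝ, Integrable (fun ω => g (Y k ω, Y (k + 1) ω)) P := fun g =>
    integrable_comp_fintype ((hm k).prodMk (hm (k + 1))) g
  have h1 : ∫ ω, (f (Y (k + 1) ω) - f (Y k ω)) ^ 2 ∂P -
      ∫ ω, (f (Y (k + 1) ω) - f (Y k ω) - meanIncr Q f (Y k ω)) ^ 2 ∂P =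
      ∫ ω, meanIncr Q f (Y k ω) ^ 2 ∂P + 2 *
        ∫ ω, meanIncr Q f (Y k ω) *
          (f (Y (k + 1) ω) - f (Y k ω) - meanIncr Q f (Y k ω)) ∂P := by
    rw [← integral_const_mul, ← integral_sub, ← integral_add]
    · congr 1
      ext ω
      ring
    · exact hip fun w => meanIncr Q f w.1 ^ 2
    · exact hip fun w => 2 * (meanIncr Q f w.1 * (f w.2 - f w.1 - meanIncr Q f w.1))
    · exact hip fun w => (f w.2 - f w.1) ^ 2
    · exact hip fun w => (f w.2 - f w.1 - meanIncr Q f w.1) ^ 2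
  rw [horth] at h1
  have h2 : 0 ≤ ∫ ω, meanIncr Q f (Y k ω) ^ 2 ∂P := integral_nonneg fun ω => sq_nonneg _
  linarith

lemma integrable_martPart_sq (hY : IsMarkovChain P ℱ Q Y) (f : S → ℝ) (k : ℕ) :
    Integrable (fun ω => martPart Q f Y k ω ^ 2) P := by
  obtain ⟨C, hC⟩ := exists_bound_martPart (Q := Q) (Y := Y) f k
  refine Integrable.of_bound (C := C ^ 2)
    (((hY.adapted_martPart f k).mono (ℱ.le k) le_rfl).pow_const 2).aestronglyMeasurable
    (Eventually.of_forall fun ω => ?_)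
  rw [Real.norm_eq_abs, abs_pow]
  exact pow_le_pow_left₀ (abs_nonneg _) (hC ω) 2

/-- By orthogonality, the square of the martingale part grows by the squares of its increments. -/
lemma setIntegral_martPart_sq_succ (hY : IsMarkovChain P ℱ Q Y) (f : S → ℝ) (k : ℕ) {A : Set Ω}
    (hA : MeasurableSet[ℱ k] A) :
    ∫ ω in A, martPart Q f Y (k + 1) ω ^ 2 ∂P = ∫ ω in A, martPart Q f Y k ω ^ 2 ∂P +
      ∫ ω in A, (f (Y (k + 1) ω) - f (Y k ω) - meanIncr Q f (Y k ω)) ^ 2 ∂P := by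
  have hm := hY.measurable
  obtain ⟨C, hC⟩ := exists_bound_martPart (Q := Q) (Y := Y) f k
  have hip : ∀ g : S × S → ℝ, Integrable (fun ω => g (Y k ω, Y (k + 1) ω)) P := fun g =>
    integrable_comp_fintype ((hm k).prodMk (hm (k + 1))) g
  have hΔ := hip fun w => f w.2 - f w.1 - meanIncr Q f w.1
  have hΔ2 := hip fun w => (f w.2 - f w.1 - meanIncr Q f w.1) ^ 2
  have hMΔ : Integrable (fun ω => martPart Q f Y k ω *
      (f (Y (k + 1) ω) - f (Y k ω) - meanIncr Q f (Y k ω))) P :=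
    hΔ.bdd_mul (c := C) ((hY.adapted_martPart f k).mono (ℱ.le k) le_rfl).aestronglyMeasurable
      (Eventually.of_forall fun ω => by simpa using hC ω)
  have horth := hY.integral_mul_incr f k (G := A.indicator (martPart Q f Y k))
    ((hY.adapted_martPart f k).indicator hA) ⟨C, fun ω => by
      by_cases h : ω ∈ A
      · simpa [h] using hC ω
      · simpa [h] using (abs_nonneg _).trans (hC ω)⟩
  have horth' : ∫ ω in A, martPart Q f Y k ω *
      (f (Y (k + 1) ω) - f (Y k ω) - meanIncr Q f (Y k ω)) ∂P = 0 := by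
    rw [← integral_indicator (ℱ.le k A hA), ← horth]
    congr 1
    ext ω
    by_cases h : ω ∈ A <;> simp [h]
  have hexp : ∀ ω, martPart Q f Y (k + 1) ω ^ 2 = martPart Q f Y k ω ^ 2 +
      (f (Y (k + 1) ω) - f (Y k ω) - meanIncr Q f (Y k ω)) ^ 2 + 2 * (martPart Q f Y k ω *
      (f (Y (k + 1) ω) - f (Y k ω) - meanIncr Q f (Y k ω))) := fun ω => by
    rw [martPart_succ]; ring
  simp_rw [hexp]
  have hsum : Integrable (fun ω => martPart Q f Y k ω ^ 2 +
      (f (Y (k + 1) ω) - f (Y k ω) - meanIncr Q f (Y k ω)) ^ 2) P :=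
    (hY.integrable_martPart_sq f k).add hΔ2
  rw [integral_add hsum.integrableOn (hMΔ.const_mul 2).integrableOn,
    integral_add (hY.integrable_martPart_sq f k).integrableOn hΔ2.integrableOn,
    integral_const_mul, horth']
  ring

/-- Doob's maximal inequality for the sum of squares of finitely many Doob martingales of a finite
Markov chain. -/
theorem maximal_ineq {ι : Type*} (hY : IsMarkovChain P ℱ Q Y) (J : Finset ι) (f : ι → S → ℝ)
    {v lam : ℝ} (hv : ∀ y, ∑ j ∈ J, ∑ z, Q y z * (f j z - f j y) ^ 2 ≤ v) (hlam : 0 < lam)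
    (n : ℕ) :
    P.real {ω | ∃ k ≤ n, lam ≤ ∑ j ∈ J, martPart Q (f j) Y k ω ^ 2} ≤ n * v / lam := by
  set F : ℕ → Ω → ℝ := fun k ω => ∑ j ∈ J, martPart Q (f j) Y k ω ^ 2 with hF
  have hFint : ∀ k, Integrable (F k) P := fun k =>
    integrable_finsetSum _ fun j _ => hY.integrable_martPart_sq (f j) k
  have hFad : ∀ k, Measurable[ℱ k] (F k) := fun k =>
    Finset.measurable_sum _ fun j _ => (hY.adapted_martPart (f j) k).pow_const 2
  have hstep : ∀ k A, MeasurableSet[ℱ k] A → ∫ ω in A, F (k + 1) ω ∂P = ∫ ω in A, F k ω ∂P +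
      ∑ j ∈ J, ∫ ω in A, (f j (Y (k + 1) ω) - f j (Y k ω) - meanIncr Q (f j) (Y k ω)) ^ 2 ∂P := by
    intro k A hA
    rw [integral_finsetSum _ fun j _ => (hY.integrable_martPart_sq (f j) _).integrableOn,
      integral_finsetSum _ fun j _ => (hY.integrable_martPart_sq (f j) _).integrableOn,
      ← Finset.sum_add_distrib]
    exact Finset.sum_congr rfl fun j _ => hY.setIntegral_martPart_sq_succ (f j) k hA
  have hsub : Submartingale F ℱ P := by
    refine submartingale_of_setIntegral_le_succ (fun k => (hFad k).stronglyMeasurable) hFint ?_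
    intro k A hA
    rw [hstep k A hA]
    exact le_add_of_nonneg_right (Finset.sum_nonneg fun j _ =>
      integral_nonneg fun ω => sq_nonneg _)
  have hmean : ∀ k : ℕ, ∫ ω, F k ω ∂P ≤ k * v := by
    intro k
    induction k with
    | zero => simp [hF, martPart]
    | succ k ih =>
      have h := hstep k Set.univ MeasurableSet.univ
      simp only [setIntegral_univ] at h
      have h2 : ∑ j ∈ J,
          ∫ ω, (f j (Y (k + 1) ω) - f j (Y k ω) - meanIncr Q (f j) (Y k ω)) ^ 2 ∂P ≤ v := by
        refine (Finset.sum_le_sum fun j _ => hY.integral_incr_sq_le (f j) k).trans ?_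
        rw [← integral_finsetSum _ fun j _ => integrable_comp_fintype (hY.measurable k)
          fun y => ∑ z, Q y z * (f j z - f j y) ^ 2]
        have := integral_mono (μ := P)
          (integrable_comp_fintype (hY.measurable k)
            fun y => ∑ j ∈ J, ∑ z, Q y z * (f j z - f j y) ^ 2)
          (integrable_const v) (fun ω => hv (Y k ω))
        simpa using this
      push_cast
      rw [h]
      linarith
  have hnn : 0 ≤ F := fun k ω => Finset.sum_nonneg fun j _ => sq_nonneg _
  have hmax := MeasureTheory.maximal_ineq hsub hnn (ε := lam.toNNReal) n
  have hset : {ω | ∃ k ≤ n, lam ≤ F k ω} = {ω | ((lam.toNNReal : ℝ≥0) : ℝ) ≤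
      (Finset.range (n + 1)).sup' Finset.nonempty_range_add_one fun k => F k ω} := by
    ext ω
    simp [Finset.le_sup'_iff, Real.coe_toNNReal _ hlam.le]
  change P.real {ω | ∃ k ≤ n, lam ≤ F k ω} ≤ _
  rw [hset]
  set B := {ω | ((lam.toNNReal : ℝ≥0) : ℝ) ≤
      (Finset.range (n + 1)).sup' Finset.nonempty_range_add_one fun k => F k ω}
  rw [le_div_iff₀ hlam, mul_comm]
  have h3 : ∫ ω in B, F n ω ∂P ≤ n * v :=
    (setIntegral_le_integral (hFint n) (Eventually.of_forall fun ω => hnn n ω)).trans (hmean n)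
  have h4 := ENNReal.toReal_mono ENNReal.ofReal_ne_top hmax
  rw [ENNReal.toReal_mul, ENNReal.toReal_ofReal (integral_nonneg fun ω => hnn n ω)] at h4
  simp only [ENNReal.coe_toReal, Real.coe_toNNReal _ hlam.le] at h4
  exact h4.trans h3

end IsMarkovChain

end MarkovChain

/-! ### The generator and its exponential -/

section Generator

variable {K : ℕ+ → ℕ+ → ℝ} {X : Config}

lemma minSize_mem (hX : X ≠ 0) : X (minSize X) ≠ 0 := by
  have h : X.support.Nonempty := Finsupp.support_nonempty_iff.2 hX
  rw [minSize, dif_pos h]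
  exact Finsupp.mem_support_iff.1 (X.support.min'_mem h)

lemma minSize_le {k : ℕ+} (hk : X k ≠ 0) : minSize X ≤ k := by
  have hk' := Finsupp.mem_support_iff.2 hk
  rw [minSize, dif_pos ⟨k, hk'⟩]
  exact X.support.min'_le k hk'

lemma eq_zero_of_lt_minSize {k : ℕ+} (hk : k < minSize X) : X k = 0 := by
  by_contra h
  exact absurd (minSize_le h) (not_le.2 hk)

lemma le_minSize {i : ℕ+} (hX : X ≠ 0) (h : ∀ k, k < i → X k = 0) : i ≤ minSize X := by
  by_contra hi
  exact minSize_mem hX (h _ (not_le.1 hi))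

lemma ne_zero_of_mass {M : ℕ} (hM : M ≠ 0) (hX : mass X = M) : X ≠ 0 := by
  rintro rfl
  exact hM (by simpa [mass] using hX.symm)

lemma mergeRate_nonneg (hK : ∀ i j, 0 ≤ K i j) {k : ℕ+} (hk : k ∈ X.support) :
    0 ≤ mergeRate K X k := by
  refine mul_nonneg (hK _ _) ?_
  have h1 : (1 : ℝ) ≤ X k := by
    exact_mod_cast Nat.one_le_iff_ne_zero.2 (Finsupp.mem_support_iff.1 hk)
  split_ifs <;> linarith

lemma mergeRate_le (hK : ∀ i j, 0 ≤ K i j) (k : ℕ+) :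
    mergeRate K X k ≤ K (minSize X) k * X k := by
  refine mul_le_mul_of_nonneg_left ?_ (hK _ _)
  split_ifs <;> linarith

/-- The total jump rate is at most of the order of the mass. -/
lemma sum_mergeRate_le (hK : ∀ i j, 0 ≤ K i j) {a : ℝ} (ha : 0 ≤ a)
    (hKa : ∀ i j : ℕ+, i ≤ j → K i j ≤ a * (i : ℕ)) :
    ∑ k ∈ X.support, mergeRate K X k ≤ a * mass X := by
  rw [mass, Finsupp.sum, Nat.cast_sum, Finset.mul_sum]
  refine Finset.sum_le_sum fun k hk => (mergeRate_le hK k).trans ?_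
  have h := minSize_le (Finsupp.mem_support_iff.1 hk)
  have h1 := hKa _ _ h
  have h2 : ((minSize X : ℕ) : ℝ) ≤ (k : ℕ) := by exact_mod_cast h
  push_cast
  rw [← mul_assoc]
  exact mul_le_mul_of_nonneg_right (h1.trans (mul_le_mul_of_nonneg_left h2 ha))
    (Nat.cast_nonneg _)

/-- A pair of particles which merges at a positive rate is really present in the configuration. -/
lemma single_add_single_le {k : ℕ+} (hk : k ∈ X.support) (hr : mergeRate K X k ≠ 0) :
    Finsupp.single (minSize X) 1 + Finsupp.single k 1 ≤ X := by
  classical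
  have hX : X ≠ 0 := by
    rintro rfl
    simp at hk
  have h1 := Nat.one_le_iff_ne_zero.2 (minSize_mem hX)
  have h2 := Nat.one_le_iff_ne_zero.2 (Finsupp.mem_support_iff.1 hk)
  intro i
  rw [Finsupp.add_apply, Finsupp.single_apply, Finsupp.single_apply]
  by_cases hki : minSize X = i <;> by_cases hkk : k = i
  · subst hkk
    have : X k ≠ 1 := by
      intro h
      apply hr
      simp [mergeRate, hki, h]
    simp only [hki, if_true]
    omega
  · subst hki
    simp [hkk]
    omega
  · subst hkk
    simp [hki]
    omega
  · simp [hki, hkk]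

/-- The definition of `merge` without truncated subtractions. -/
lemma merge_add {k : ℕ+} (hk : k ∈ X.support) (hr : mergeRate K X k ≠ 0) :
    merge X k + (Finsupp.single (minSize X) 1 + Finsupp.single k 1) =
      X + Finsupp.single (minSize X + k) 1 := by
  have h := single_add_single_le hk hr
  have h2 : X - Finsupp.single (minSize X) 1 - Finsupp.single k 1 +
      (Finsupp.single (minSize X) 1 + Finsupp.single k 1) = X := by
    rw [tsub_tsub]
    exact tsub_add_cancel_of_le h
  rw [merge, add_right_comm, h2]

lemma mass_add (X Y : Config) : mass (X + Y) = mass X + mass Y :=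
  Finsupp.sum_add_index' (by simp) (by intros; ring)

lemma mass_single (i : ℕ+) (n : ℕ) : mass (Finsupp.single i n) = i * n :=
  Finsupp.sum_single_index (by simp)

lemma mass_merge {k : ℕ+} (hk : k ∈ X.support) (hr : mergeRate K X k ≠ 0) :
    mass (merge X k) = mass X := by
  have h := congrArg mass (merge_add hk hr)
  simp only [mass_add, mass_single, PNat.add_coe] at h
  omega

lemma merge_apply {k : ℕ+} (hk : k ∈ X.support) (hr : mergeRate K X k ≠ 0) (j : ℕ+) :
    (merge X k j : ℝ) = X j - (if j = minSize X then 1 else 0) - (if j = k then 1 else 0) +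
      (if j = minSize X + k then 1 else 0) := by
  have h := congrArg (fun Z : Config => ((Z j : ℕ) : ℝ)) (merge_add hk hr)
  simp only [Finsupp.add_apply, Finsupp.single_apply, eq_comm (b := j)] at h
  push_cast at h
  linarith

lemma minSize_le_merge {k : ℕ+} (hk : k ∈ X.support) (hr : mergeRate K X k ≠ 0) :
    minSize X ≤ minSize (merge X k) := by
  refine le_minSize ?_ fun i hi => ?_
  · have : merge X k (minSize X + k) ≠ 0 := by
      simp [merge]
    rintro h
    simp [h] at this
  · have h1 := merge_apply hk hr i
    have hk' := minSize_le (Finsupp.mem_support_iff.1 hk)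
    rw [eq_zero_of_lt_minSize hi, if_neg hi.ne, if_neg (hi.trans_le hk').ne,
      if_neg (hi.trans (PNat.lt_add_right _ _)).ne] at h1
    have h2 : (merge X k i : ℝ) = 0 := by simpa using h1
    exact_mod_cast h2

/-- The generator acts on functions by `(L f)(X) = ∑ j, mergeRate K X j * (f (merge X j) - f X)`. -/
lemma sum_generator_mul (M : ℕ) (Y : Shell M) (f : Config → ℝ) :
    ∑ Z, generator K M Y Z * f Z.1 =
      ∑ k ∈ Y.1.support, mergeRate K Y.1 k * (f (merge Y.1 k) - f Y.1) := by
  classical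
  simp only [generator, Finset.sum_mul]
  rw [Finset.sum_comm]
  refine Finset.sum_congr rfl fun k hk => ?_
  by_cases hr : mergeRate K Y.1 k = 0
  · simp [hr]
  have hm : mass (merge Y.1 k) = M := (mass_merge hk hr).trans Y.2
  have h1 : ∑ Z : Shell M, (if Z.1 = merge Y.1 k then (1 : ℝ) else 0) * f Z.1 =
      f (merge Y.1 k) := by
    rw [Finset.sum_eq_single (⟨merge Y.1 k, hm⟩ : Shell M)]
    · simp
    · intro Z _ hZ
      rw [if_neg fun h => hZ (Subtype.ext h), zero_mul]
    · simp
  have h2 : ∑ Z : Shell M, (if Z.1 = Y.1 then (1 : ℝ) else 0) * f Z.1 = f Y.1 := by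
    rw [Finset.sum_eq_single Y]
    · simp
    · intro Z _ hZ
      rw [if_neg fun h => hZ (Subtype.ext h), zero_mul]
    · simp
  rw [← h1, ← h2, ← Finset.sum_sub_distrib, Finset.mul_sum]
  exact Finset.sum_congr rfl fun Z _ => by ring

/-- The minimal size does not decrease in a jump. -/
lemma generator_blockTriangular (M : ℕ) :
    (generator K M).BlockTriangular fun Y : Shell M => minSize Y.1 := by
  intro Y Z hZY
  refine Finset.sum_eq_zero fun k hk => ?_
  by_cases hr : mergeRate K Y.1 k = 0
  · simp [hr]
  have h1 : Z.1 ≠ merge Y.1 k := by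
    intro h
    have := minSize_le_merge hk hr
    rw [← h] at this
    exact absurd this (not_le.2 hZY)
  have h2 : Z.1 ≠ Y.1 := by
    intro h
    simp [h] at hZY
  simp [h1, h2]

end Generator

section Exponential

variable {S : Type*} [Fintype S] [DecidableEq S]

lemma hasDerivAt_exp_smul_apply (G : Matrix S S ℝ) (t : ℝ) (y z : S) :
    HasDerivAt (fun u : ℝ => NormedSpace.exp (u • G) y z)
      ((NormedSpace.exp (t • G) * G) y z) t := by
  have h : HasDerivAt (fun u : ℝ => NormedSpace.exp (u • G)) (NormedSpace.exp (t • G) * G) t := by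
    open scoped Matrix.Norms.Operator in
    exact hasDerivAt_exp_smul_const (𝕂 := ℝ) G t
  exact (hasDerivAt_pi.1 ((hasDerivAt_pi.1 h) y)) z

/-- The exponential of a generator has unit row sums, since the derivative of a row sum
vanishes. -/
lemma sum_exp_smul_row {G : Matrix S S ℝ} (hG : ∀ y, ∑ z, G y z = 0) (t : ℝ) (y : S) :
    ∑ z, NormedSpace.exp (t • G) y z = 1 := by
  have hd : ∀ t, HasDerivAt (fun u : ℝ => ∑ z, NormedSpace.exp (u • G) y z) 0 t := by
    intro t
    have h := HasDerivAt.fun_sum (u := Finset.univ)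
      fun z _ => hasDerivAt_exp_smul_apply G t y z
    have hz : ∑ z, (NormedSpace.exp (t • G) * G) y z = 0 := by
      simp only [Matrix.mul_apply]
      rw [Finset.sum_comm]
      simp [← Finset.mul_sum, hG]
    rwa [hz] at h
  have h : ∑ z, NormedSpace.exp (t • G) y z = ∑ z, NormedSpace.exp ((0 : ℝ) • G) y z :=
    is_const_of_deriv_eq_zero (fun t => (hd t).differentiableAt) (fun t => (hd t).deriv) t 0
  rw [h]
  simp [Matrix.one_apply]

/-- To first order in `h`, the transition matrix `exp (h • G)` acts off the diagonal as `h • G`. -/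
lemma eventually_abs_exp_smul_sub_le (G : Matrix S S ℝ) (φ : S → S → ℝ) (hφ : ∀ y, φ y y = 0)
    {η : ℝ} (hη : 0 < η) :
    ∀ᶠ h in 𝓝[>] (0 : ℝ), ∀ y,
      |∑ z, NormedSpace.exp (h • G) y z * φ y z - h * ∑ z, G y z * φ y z| ≤ h * η := by
  rw [eventually_all]
  intro y
  have hd : HasDerivAt (fun u : ℝ => ∑ z, NormedSpace.exp (u • G) y z * φ y z)
      (∑ z, G y z * φ y z) 0 := by
    have h := HasDerivAt.fun_sum (u := Finset.univ)
      fun z _ => (hasDerivAt_exp_smul_apply G 0 y z).mul_const (φ y z)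
    simpa using h
  have h1 := (hasDerivAt_iff_isLittleO.1 hd).def hη
  filter_upwards [nhdsWithin_le_nhds h1, self_mem_nhdsWithin] with h hh hpos
  have hz : ∑ z, NormedSpace.exp ((0 : ℝ) • G) y z * φ y z = 0 := by
    refine Finset.sum_eq_zero fun z _ => ?_
    by_cases hyz : y = z
    · subst hyz
      simp [hφ]
    · simp [hyz]
  rw [hz] at hh
  simp only [sub_zero, smul_eq_mul, Real.norm_eq_abs] at hh
  rw [abs_of_pos (Set.mem_Ioi.1 hpos)] at hh
  linarith

end Exponential

/-! ### The drifts of the deterministic and of the stochastic dynamics -/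

section Drift

variable {K : ℕ+ → ℕ+ → ℝ} {i : ℕ+} {A : ℝ} {u v : ℕ+ → ℝ}

lemma drift_of_lt {j : ℕ+} (h : j < i) : drift K i u j = 0 := by
  simp [drift, h]

lemma drift_self : drift K i u i =
    -(2 * K i i * u i + ∑' k, if i < k then K i k * u k else 0) := by
  have h : ∑' k : Set.Ioi i, K i k * u k = ∑' k, if i < k then K i k * u k else 0 := by
    rw [tsum_subtype (Set.Ioi i) fun k => K i k * u k]
    simp only [Set.indicator_apply, Set.mem_Ioi]
  simp only [drift, lt_irrefl, if_true, if_false]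
  rw [h]
  ring

lemma drift_of_gt {j : ℕ+} (h : i < j) :
    drift K i u j = K (j - i) i * u (j - i) - K i j * u j := by
  simp [drift, h.not_gt, h.ne']

lemma kernel_bound_nonneg (hK : ∀ i j, 0 ≤ K i j) (hA : ∀ k, i ≤ k → K i k ≤ A) : 0 ≤ A :=
  (hK i i).trans (hA i le_rfl)

lemma summable_drift_term (hK : ∀ i j, 0 ≤ K i j) (hA : ∀ k, i ≤ k → K i k ≤ A)
    (hu : Summable fun k => |u k|) : Summable fun k => if i < k then K i k * u k else 0 := by
  refine Summable.of_norm_bounded (hu.mul_left A) fun k => ?_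
  split_ifs with h
  · rw [Real.norm_eq_abs, abs_mul, abs_of_nonneg (hK i k)]
    exact mul_le_mul_of_nonneg_right (hA k h.le) (abs_nonneg _)
  · simpa using mul_nonneg (kernel_bound_nonneg hK hA) (abs_nonneg _)

lemma drift_sub (hK : ∀ i j, 0 ≤ K i j) (hA : ∀ k, i ≤ k → K i k ≤ A)
    (hu : Summable fun k => |u k|) (hv : Summable fun k => |v k|) (j : ℕ+) :
    drift K i (u - v) j = drift K i u j - drift K i v j := by
  rcases lt_trichotomy j i with h | h | h
  · simp [drift_of_lt h]
  · subst h
    have h1 := (summable_drift_term hK hA hu).tsum_sub (summable_drift_term hK hA hv)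
    have h2 : ∀ k, (if j < k then K j k * (u - v) k else 0) =
        (if j < k then K j k * u k else 0) - (if j < k then K j k * v k else 0) := by
      intro k
      split_ifs <;> simp [mul_sub]
    rw [drift_self, drift_self, drift_self, tsum_congr h2, h1, Pi.sub_apply]
    ring
  · rw [drift_of_gt h, drift_of_gt h, drift_of_gt h, Pi.sub_apply, Pi.sub_apply]
    ring

/-- The vector field `b^{(i)}` is bounded in `ℓ¹` on sequences supported in `[i, ∞)`. -/
lemma sum_abs_drift_le (hK : ∀ i j, 0 ≤ K i j) (hsymm : ∀ i j, K i j = K j i)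
    (hA : ∀ k, i ≤ k → K i k ≤ A) (hu : Summable fun k => |u k|) (hsupp : ∀ k, k < i → u k = 0)
    (J : Finset ℕ+) : ∑ j ∈ J, |drift K i u j| ≤ 4 * A * ∑' k, |u k| := by
  have hA0 := kernel_bound_nonneg hK hA
  set U := ∑' k, |u k| with hU
  have hU0 : 0 ≤ U := tsum_nonneg fun k => abs_nonneg _
  have hle : ∀ s : Finset ℕ+, ∑ k ∈ s, |u k| ≤ U := fun s =>
    hu.sum_le_tsum s fun _ _ => abs_nonneg _
  have h1 : ∀ j, |drift K i u j| ≤ (if j = i then 2 * A * U else 0) + A * |u j| +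
      (if i < j then A * |u (j - i)| else 0) := by
    intro j
    have hAu : 0 ≤ A * |u j| := mul_nonneg hA0 (abs_nonneg _)
    rcases lt_trichotomy j i with h | h | h
    · simp [drift_of_lt h, h.ne, h.not_gt, hAu]
    · subst h
      have hs := summable_drift_term hK hA hu
      have h2 : |∑' k, if j < k then K j k * u k else 0| ≤
          A * ∑' k, if k = j then 0 else |u k| := by
        have hs2 : Summable fun k => if k = j then 0 else |u k| :=
          Summable.of_nonneg_of_le (fun k => by split_ifs <;> simp)
            (fun k => by split_ifs <;> simp) hu
        rw [← tsum_mul_left, ← Real.norm_eq_abs]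
        refine tsum_of_norm_bounded (hs2.mul_left A).hasSum fun k => ?_
        rw [Real.norm_eq_abs]
        split_ifs with ha hb hb
        · exact absurd hb ha.ne'
        · rw [abs_mul, abs_of_nonneg (hK j k)]
          exact mul_le_mul_of_nonneg_right (hA k ha.le) (abs_nonneg _)
        · simp
        · simpa using mul_nonneg hA0 (abs_nonneg (u k))
      have h3 : U = |u j| + ∑' k, if k = j then 0 else |u k| := hu.tsum_eq_add_tsum_ite j
      have h4 : K j j * |u j| ≤ A * |u j| :=
        mul_le_mul_of_nonneg_right (hA j le_rfl) (abs_nonneg _)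
      have h5 : 0 ≤ ∑' k, if k = j then 0 else |u k| :=
        tsum_nonneg fun k => by split_ifs <;> simp
      rw [drift_self, abs_neg, if_pos rfl, if_neg (lt_irrefl _)]
      refine (abs_add_le _ _).trans ?_
      rw [abs_mul, abs_mul, abs_two, abs_of_nonneg (hK j j), h3]
      nlinarith [mul_nonneg hA0 h5]
    · rw [drift_of_gt h, if_neg h.ne', if_pos h]
      refine (abs_sub _ _).trans ?_
      rw [abs_mul, abs_mul, abs_of_nonneg (hK _ _), abs_of_nonneg (hK _ _)]
      have h2 : K i j * |u j| ≤ A * |u j| := mul_le_mul_of_nonneg_right (hA j h.le) (abs_nonneg _)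
      have h3 : K (j - i) i * |u (j - i)| ≤ A * |u (j - i)| := by
        rcases lt_or_ge (j - i) i with h4 | h4
        · simp [hsupp _ h4]
        · rw [hsymm]
          exact mul_le_mul_of_nonneg_right (hA _ h4) (abs_nonneg _)
      linarith
  refine (Finset.sum_le_sum fun j _ => h1 j).trans ?_
  rw [Finset.sum_add_distrib, Finset.sum_add_distrib]
  have h2 : ∑ j ∈ J, (if j = i then 2 * A * U else 0) ≤ 2 * A * U := by
    rw [Finset.sum_ite_eq']
    split_ifs
    · exact le_rfl
    · positivity
  have h3 : ∑ j ∈ J, A * |u j| ≤ A * U := by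
    rw [← Finset.mul_sum]
    exact mul_le_mul_of_nonneg_left (hle J) hA0
  have h4 : ∑ j ∈ J, (if i < j then A * |u (j - i)| else 0) ≤ A * U := by
    rw [← Finset.sum_filter, ← Finset.mul_sum]
    refine mul_le_mul_of_nonneg_left ?_ hA0
    have hinj : Set.InjOn (fun j : ℕ+ => j - i) (J.filter fun j => i < j) := by
      intro p hp q hq hpq
      have hp' := (Finset.mem_filter.1 hp).2
      have hq' := (Finset.mem_filter.1 hq).2
      simp only at hpq
      rw [← PNat.add_sub_of_lt hp', ← PNat.add_sub_of_lt hq', hpq]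
    rw [← Finset.sum_image (f := fun k => |u k|) hinj]
    exact hle _
  linarith

/-- The component of minimal size decreases at a rate which is bounded below in terms of the
`ℓ¹`-norm. -/
lemma drift_self_le (hK : ∀ i j, 0 ≤ K i j) (hA : ∀ k, i ≤ k → K i k ≤ A) {δ : ℝ}
    (hδ : ∀ k, i ≤ k → δ ≤ K i k) (hu : Summable fun k => |u k|) (hu0 : ∀ k, 0 ≤ u k)
    (hsupp : ∀ k, k < i → u k = 0) : drift K i u i ≤ -(δ * ∑' k, u k) := by
  have hs : Summable u := hu.of_abs
  have hs1 := summable_drift_term hK hA hu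
  rw [drift_self, neg_le_neg_iff]
  have h1 := hs.tsum_eq_add_tsum_ite i
  have hs2 : Summable fun k => if k = i then 0 else u k :=
    Summable.of_nonneg_of_le (fun k => by split_ifs <;> simp [hu0])
      (fun k => by split_ifs <;> simp [hu0]) hs
  have h2 : δ * ∑' k, (if k = i then 0 else u k) ≤ ∑' k, if i < k then K i k * u k else 0 := by
    rw [← tsum_mul_left]
    refine (hs2.mul_left δ).tsum_le_tsum (fun k => ?_) hs1
    rcases lt_trichotomy k i with h | h | h
    · simp [h.ne, h.not_gt, hsupp k h]
    · simp [h]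
    · rw [if_neg h.ne', if_pos h]
      exact mul_le_mul_of_nonneg_right (hδ k h.le) (hu0 k)
  have h3 : δ * u i ≤ K i i * u i := mul_le_mul_of_nonneg_right (hδ i le_rfl) (hu0 i)
  have h4 : 0 ≤ K i i * u i := mul_nonneg (hK _ _) (hu0 _)
  rw [h1]
  nlinarith

end Drift

section GenDrift

variable {K : ℕ+ → ℕ+ → ℝ} {X : Config}

/-- The drift of the renormalized stochastic process: the generator applied to its components. -/
noncomputable def genDrift (K : ℕ+ → ℕ+ → ℝ) (N : ℕ) (X : Config) (j : ℕ+) : ℝ :=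
  ∑ k ∈ X.support, mergeRate K X k * (renorm N (merge X k) j - renorm N X j)

/-- The rates vanish off the support: there the only term which might survive is the correction
`-1` at the minimal size, which belongs to the support. -/
lemma mergeRate_eq_zero_of_notMem (hX : X ≠ 0) {k : ℕ+} (hk : k ∉ X.support) :
    mergeRate K X k = 0 := by
  have h := Finsupp.notMem_support_iff.1 hk
  have : k ≠ minSize X := fun h' => minSize_mem hX (h' ▸ h)
  simp [mergeRate, h, this]

/-- The drift of the renormalized stochastic process is that of the deterministic equation, up to
the correction due to the exclusion of self-interactions. -/
lemma genDrift_eq (hsymm : ∀ i j, K i j = K j i) (hX : X ≠ 0) (N : ℕ) (j : ℕ+) :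
    genDrift K N X j = drift K (minSize X) (renorm N X) j +
      K (minSize X) (minSize X) / N *
        ((if j = minSize X then 2 else 0) - if j = minSize X + minSize X then 1 else 0) := by
  set l := minSize X with hl
  have h1 : genDrift K N X j = (∑ k ∈ X.support, mergeRate K X k *
      (-(if j = l then 1 else 0) - (if j = k then 1 else 0) +
        (if j = l + k then 1 else 0))) / N := by
    rw [genDrift, Finset.sum_div]
    refine Finset.sum_congr rfl fun k hk => ?_
    by_cases hr : mergeRate K X k = 0
    · simp [hr]
    · rw [renorm, renorm, merge_apply hk hr j]
      ring
  have h2 : ∑ k ∈ X.support, mergeRate K X k *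
      (-(if j = l then 1 else 0) - (if j = k then 1 else 0) + (if j = l + k then 1 else 0)) =
      -(if j = l then ∑ k ∈ X.support, mergeRate K X k else 0) - mergeRate K X j +
        (if l < j then mergeRate K X (j - l) else 0) := by
    have ha : ∑ k ∈ X.support, mergeRate K X k * (if j = k then 1 else 0) = mergeRate K X j := by
      simp only [mul_ite, mul_one, mul_zero, Finset.sum_ite_eq]
      split_ifs with h
      · rfl
      · exact (mergeRate_eq_zero_of_notMem hX h).symm
    have hb : ∑ k ∈ X.support, mergeRate K X k * (if j = l + k then 1 else 0) =
        if l < j then mergeRate K X (j - l) else 0 := by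
      split_ifs with h
      · have : ∀ k, j = l + k ↔ j - l = k := fun k => by
          constructor
          · intro hk
            rw [hk]
            exact PNat.coe_injective (by simp [PNat.sub_coe, PNat.lt_add_right])
          · rintro rfl
            exact (PNat.add_sub_of_lt h).symm
        simp only [this, mul_ite, mul_one, mul_zero, Finset.sum_ite_eq]
        split_ifs with h'
        · rfl
        · exact (mergeRate_eq_zero_of_notMem hX h').symm
      · refine Finset.sum_eq_zero fun k _ => ?_
        rw [if_neg, mul_zero]
        rintro rfl
        exact h (PNat.lt_add_right _ _)
    simp only [mul_add, mul_sub, Finset.sum_add_distrib, Finset.sum_sub_distrib, ha, hb]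
    congr 2
    split_ifs <;> simp
  rw [h1, h2]
  rcases lt_trichotomy j l with h | h | h
  · have hj : mergeRate K X j = 0 := mergeRate_eq_zero_of_notMem hX <| by
      simpa using eq_zero_of_lt_minSize h
    have hjl : j ≠ l + l := (h.trans (PNat.lt_add_right _ _)).ne
    simp [drift_of_lt h, h.ne, h.not_gt, hj, hjl]
  · have hjl : l ≠ l + l := (PNat.lt_add_right _ _).ne
    have hmem : l ∈ X.support := Finsupp.mem_support_iff.2 (minSize_mem hX)
    have h3 : ∑ k ∈ X.support, mergeRate K X k = mergeRate K X l +
        ∑ k ∈ X.support, if l < k then K l k * X k else 0 := by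
      rw [← Finset.add_sum_erase _ _ hmem, ← Finset.add_sum_erase _ (fun k =>
        if l < k then K l k * (X k : ℝ) else 0) hmem, if_neg (lt_irrefl _), zero_add]
      congr 1
      refine Finset.sum_congr rfl fun k hk => ?_
      have hk' := Finset.mem_erase.1 hk
      have hlk : l < k := lt_of_le_of_ne (minSize_le (Finsupp.mem_support_iff.1 hk'.2)) hk'.1.symm
      rw [if_pos hlk, mergeRate, ← hl, if_neg hk'.1, sub_zero]
    have h4 : ∑' k, (if l < k then K l k * renorm N X k else 0) =
        (∑ k ∈ X.support, if l < k then K l k * X k else 0) / N := by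
      rw [tsum_eq_sum (s := X.support), Finset.sum_div]
      · refine Finset.sum_congr rfl fun k _ => ?_
        split_ifs <;> simp [renorm, mul_div_assoc]
      · intro k hk
        simp [renorm, Finsupp.notMem_support_iff.1 hk]
    rw [h, drift_self, h4, h3, if_pos rfl, if_pos rfl, if_neg hjl, if_neg (lt_irrefl _)]
    simp only [mergeRate, ← hl, if_true, renorm]
    ring
  · rw [drift_of_gt h, if_neg h.ne', if_neg h.ne', if_pos h, mergeRate, mergeRate, ← hl,
      if_neg h.ne', hsymm (j - l) l, renorm, renorm]
    have h5 : (j - l = l) ↔ j = l + l := by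
      constructor
      · intro h6
        have := PNat.add_sub_of_lt h
        rw [h6] at this
        exact this.symm
      · rintro rfl
        exact PNat.coe_injective (by simp)
    simp only [h5]
    split_ifs with h6
    · have h7 : j - l = l := h5.2 h6
      rw [h7]
      ring
    · ring

end GenDrift

/-! ### First moments and tails -/

section Moments

variable {u : ℕ+ → ℝ}

lemma abs_le_moment_term (u : ℕ+ → ℝ) (k : ℕ+) : |u k| ≤ (k : ℕ) * |u k| := by
  have : (1 : ℝ) ≤ (k : ℕ) := by exact_mod_cast Nat.one_le_iff_ne_zero.2 k.ne_zero
  nlinarith [abs_nonneg (u k)]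

lemma summable_abs_of_moment (hu : Summable fun k : ℕ+ => ((k : ℕ) : ℝ) * |u k|) :
    Summable fun k => |u k| :=
  Summable.of_nonneg_of_le (fun _ => abs_nonneg _) (abs_le_moment_term u) hu

lemma mul_tsum_abs_le (hu : Summable fun k : ℕ+ => ((k : ℕ) : ℝ) * |u k|) {i : ℕ+}
    (hsupp : ∀ k, k < i → u k = 0) :
    ((i : ℕ) : ℝ) * ∑' k, |u k| ≤ ∑' k : ℕ+, ((k : ℕ) : ℝ) * |u k| := by
  rw [← tsum_mul_left]
  refine ((summable_abs_of_moment hu).mul_left _).tsum_le_tsum (fun k => ?_) hu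
  rcases lt_or_ge k i with h | h
  · simp [hsupp k h]
  · exact mul_le_mul_of_nonneg_right (by exact_mod_cast h) (abs_nonneg _)

/-- The first moment controls the tail of the `ℓ¹`-norm. -/
lemma tsum_abs_le_sum_add (hu : Summable fun k : ℕ+ => ((k : ℕ) : ℝ) * |u k|) (R : ℕ+) :
    ∑' k, |u k| ≤ ∑ k ∈ Finset.Iic R, |u k| +
      (∑' k : ℕ+, ((k : ℕ) : ℝ) * |u k|) / (R : ℕ) := by
  have hR : (0 : ℝ) < (R : ℕ) := by exact_mod_cast R.pos
  rw [← (summable_abs_of_moment hu).sum_add_tsum_compl (s := Finset.Iic R), ← tsum_div_const]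
  gcongr
  rw [tsum_subtype (↑(Finset.Iic R))ᶜ fun k => |u k|]
  refine Summable.tsum_le_tsum (fun k => ?_) ((summable_abs_of_moment hu).indicator _)
    (hu.div_const _)
  by_cases hk : k ≤ R
  · simp only [Set.indicator_apply, Set.mem_compl_iff, Finset.coe_Iic, Set.mem_Iic, hk,
      not_true_eq_false, if_false]
    positivity
  · simp only [Set.indicator_apply, Set.mem_compl_iff, Finset.coe_Iic, Set.mem_Iic, hk,
      not_false_eq_true, if_true]
    rw [le_div_iff₀ hR, mul_comm]
    exact mul_le_mul_of_nonneg_right (by exact_mod_cast (not_le.1 hk).le) (abs_nonneg _)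

lemma momentNorm_eq (u : ℕ+ → ℝ) :
    momentNorm u = ∑' k : ℕ+, ENNReal.ofReal (((k : ℕ) : ℝ) * |u k|) := by
  refine tsum_congr fun k => ?_
  rw [ENNReal.ofReal_mul (Nat.cast_nonneg _), ENNReal.ofReal_natCast, ← Real.norm_eq_abs,
    ofReal_norm]

lemma summable_moment (hu : momentNorm u ≠ ⊤) :
    Summable fun k : ℕ+ => ((k : ℕ) : ℝ) * |u k| := by
  rw [momentNorm_eq] at hu
  refine (ENNReal.summable_toReal hu).congr fun k => ?_
  rw [ENNReal.toReal_ofReal (by positivity)]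

lemma toReal_momentNorm (hu : momentNorm u ≠ ⊤) :
    (momentNorm u).toReal = ∑' k : ℕ+, ((k : ℕ) : ℝ) * |u k| := by
  rw [momentNorm_eq, ← ENNReal.ofReal_tsum_of_nonneg (fun k => by positivity) (summable_moment hu),
    ENNReal.toReal_ofReal (tsum_nonneg fun k => by positivity)]

lemma l1Norm_eq (hu : Summable fun k => |u k|) : l1Norm u = ENNReal.ofReal (∑' k, |u k|) := by
  rw [ENNReal.ofReal_tsum_of_nonneg (fun k => abs_nonneg _) hu]
  refine tsum_congr fun k => ?_
  rw [← Real.norm_eq_abs, ofReal_norm]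

lemma l1Norm_le_momentNorm (u : ℕ+ → ℝ) : l1Norm u ≤ momentNorm u := by
  refine ENNReal.tsum_le_tsum fun k => ?_
  have : (1 : ℝ≥0∞) ≤ ((k : ℕ) : ℝ≥0∞) := by exact_mod_cast Nat.one_le_iff_ne_zero.2 k.ne_zero
  exact le_mul_of_one_le_left' this

lemma momentNorm_add_le (u v : ℕ+ → ℝ) : momentNorm (u + v) ≤ momentNorm u + momentNorm v := by
  rw [momentNorm, momentNorm, momentNorm, ← ENNReal.tsum_add]
  refine ENNReal.tsum_le_tsum fun k => ?_
  rw [← mul_add]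
  exact mul_le_mul_right (enorm_add_le _ _) _

lemma enorm_apply_le_momentNorm (u : ℕ+ → ℝ) (k : ℕ+) : ‖u k‖ₑ ≤ momentNorm u :=
  (ENNReal.le_tsum (f := fun k => ‖u k‖ₑ) k).trans (l1Norm_le_momentNorm u)

lemma summable_moment_renorm (N : ℕ) (X : Config) :
    Summable fun k : ℕ+ => ((k : ℕ) : ℝ) * |renorm N X k| :=
  summable_of_ne_finset_zero (s := X.support) fun k hk => by
    simp [renorm, Finsupp.notMem_support_iff.1 hk]

lemma tsum_moment_renorm (N : ℕ) (X : Config) :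
    ∑' k : ℕ+, ((k : ℕ) : ℝ) * |renorm N X k| = mass X / N := by
  rw [tsum_eq_sum (s := X.support) fun k hk => by
    simp [renorm, Finsupp.notMem_support_iff.1 hk], mass, Finsupp.sum, Nat.cast_sum,
    Finset.sum_div]
  refine Finset.sum_congr rfl fun k _ => ?_
  rw [renorm, abs_of_nonneg (by positivity)]
  push_cast
  ring

lemma summable_moment_sub {v : ℕ+ → ℝ} (hu : Summable fun k : ℕ+ => ((k : ℕ) : ℝ) * |u k|)
    (hv : Summable fun k : ℕ+ => ((k : ℕ) : ℝ) * |v k|) :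
    Summable fun k : ℕ+ => ((k : ℕ) : ℝ) * |(u - v) k| :=
  Summable.of_nonneg_of_le (fun k => by positivity) (fun k => by
    rw [← mul_add]
    exact mul_le_mul_of_nonneg_left (abs_sub _ _) (Nat.cast_nonneg _)) (hu.add hv)

lemma tsum_moment_sub_le {v : ℕ+ → ℝ} (hu : Summable fun k : ℕ+ => ((k : ℕ) : ℝ) * |u k|)
    (hv : Summable fun k : ℕ+ => ((k : ℕ) : ℝ) * |v k|) :
    ∑' k : ℕ+, ((k : ℕ) : ℝ) * |(u - v) k| ≤
      ∑' k : ℕ+, ((k : ℕ) : ℝ) * |u k| + ∑' k : ℕ+, ((k : ℕ) : ℝ) * |v k| := by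
  rw [← hu.tsum_add hv]
  refine (summable_moment_sub hu hv).tsum_le_tsum (fun k => ?_) (hu.add hv)
  rw [← mul_add]
  exact mul_le_mul_of_nonneg_left (abs_sub _ _) (Nat.cast_nonneg _)

/-- The linear growth of the minimal interactions makes the drift bounded, uniformly in the minimal
size, on sequences with bounded first moment. -/
lemma sum_abs_drift_le_moment {K : ℕ+ → ℕ+ → ℝ} (hK : ∀ i j, 0 ≤ K i j)
    (hsymm : ∀ i j, K i j = K j i) {a : ℝ} (ha : 0 ≤ a)
    (hKa : ∀ i j : ℕ+, i ≤ j → K i j ≤ a * (i : ℕ)) {i : ℕ+}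
    (hu : Summable fun k : ℕ+ => ((k : ℕ) : ℝ) * |u k|) (hsupp : ∀ k, k < i → u k = 0)
    (J : Finset ℕ+) :
    ∑ j ∈ J, |drift K i u j| ≤ 4 * a * ∑' k : ℕ+, ((k : ℕ) : ℝ) * |u k| := by
  refine (sum_abs_drift_le hK hsymm (hKa i) (summable_abs_of_moment hu) hsupp J).trans ?_
  have h := mul_le_mul_of_nonneg_left (mul_tsum_abs_le hu hsupp) (mul_nonneg zero_le_four ha)
  linarith

end Moments

/-! ### The deterministic solution on compact time intervals -/

section Solution

variable {K : ℕ+ → ℕ+ → ℝ} {x₀ : ℕ+ → ℝ} {τ : ℕ → ℝ} {ℓ : ℝ → ℕ+} {x : ℝ → ℕ+ → ℝ} {T : ℝ}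

lemma Icc_subset_lifeInterval (hT : (T : EReal) < lifespan τ) :
    Set.Icc 0 T ⊆ lifeInterval τ := fun _ ht =>
  ⟨ht.1, (EReal.coe_le_coe_iff.2 ht.2).trans_lt hT⟩

namespace IsSolution

lemma exists_stage (hx : IsSolution K x₀ τ ℓ x) {t : ℝ} (ht : t ∈ lifeInterval τ) :
    ∃ i : ℕ, t ∈ Set.Ico (τ i) (τ (i + 1)) ∧ ℓ t = i.succPNat := by
  obtain ⟨n, hn⟩ := lt_iSup_iff.1 ht.2
  have hn' : t < τ n := by exact_mod_cast hn
  have hex : ∃ n, t < τ n := ⟨n, hn'⟩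
  classical
  have h1 := Nat.find_spec hex
  have h0 : Nat.find hex ≠ 0 := by
    intro h
    rw [h, hx.time_zero] at h1
    exact absurd ht.1 (not_le.2 h1)
  obtain ⟨i, hi⟩ := Nat.exists_eq_succ_of_ne_zero h0
  rw [hi] at h1
  have h2 : τ i ≤ t := not_lt.1 (Nat.find_min hex (by omega))
  exact ⟨i, ⟨h2, h1⟩, hx.minSize_eq i t ⟨h2, h1⟩⟩

lemma minSize_mono (hx : IsSolution K x₀ τ ℓ x) : MonotoneOn ℓ (lifeInterval τ) := by
  intro s hs t ht hst
  obtain ⟨i, hi, hi'⟩ := hx.exists_stage hs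
  obtain ⟨j, hj, hj'⟩ := hx.exists_stage ht
  rw [hi', hj']
  have : i < j + 1 := hx.time_strictMono.lt_iff_lt.1 ((hi.1.trans hst).trans_lt hj.2)
  exact Nat.succPNat_le_succPNat.2 (by omega)

lemma nonneg (hx : IsSolution K x₀ τ ℓ x) {t : ℝ} (ht : t ∈ lifeInterval τ) (j : ℕ+) :
    0 ≤ x t j := (hx.mem t ht).1.2 j

lemma eq_zero_of_lt (hx : IsSolution K x₀ τ ℓ x) {t : ℝ} (ht : t ∈ lifeInterval τ) {j : ℕ+}
    (hj : j < ℓ t) : x t j = 0 := (hx.mem t ht).1.1.2 j hj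

lemma summable_moment (hx : IsSolution K x₀ τ ℓ x) {t : ℝ} (ht : t ∈ lifeInterval τ) :
    Summable fun k : ℕ+ => ((k : ℕ) : ℝ) * |x t k| :=
  MinDriven.summable_moment (hx.mem t ht).1.1.1.ne

lemma tsum_pos (hx : IsSolution K x₀ τ ℓ x) {t : ℝ} (ht : t ∈ lifeInterval τ) :
    0 < ∑' k, x t k := by
  have hs := (summable_abs_of_moment (hx.summable_moment ht)).of_abs
  have hne : ∃ j, x t j ≠ 0 := by
    by_contra! h
    exact (hx.mem t ht).2 ⟨(hx.mem t ht).1.1.1, fun i _ => h i⟩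
  obtain ⟨j, hj⟩ := hne
  exact hs.tsum_pos (hx.nonneg ht) j (lt_of_le_of_ne (hx.nonneg ht j) hj.symm)

lemma eventually_momentNorm_sub_lt (hx : IsSolution K x₀ τ ℓ x) {s : ℝ} (hs : s ∈ lifeInterval τ)
    {η : ℝ≥0∞} (hη : 0 < η) : ∀ᶠ r in 𝓝[lifeInterval τ] s, momentNorm (x r - x s) < η :=
  (hx.continuous s hs).eventually_lt_const hη

lemma continuousOn_apply (hx : IsSolution K x₀ τ ℓ x) (j : ℕ+) :
    ContinuousOn (fun t => x t j) (lifeInterval τ) := by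
  intro s hs
  rw [ContinuousWithinAt, tendsto_iff_edist_tendsto_0]
  refine tendsto_of_tendsto_of_tendsto_of_le_of_le tendsto_const_nhds (hx.continuous s hs)
    (fun _ => zero_le) fun r => ?_
  rw [edist_eq_enorm_sub]
  exact enorm_apply_le_momentNorm (x r - x s) j

/-- The first moment is bounded on compact time intervals, by continuity. -/
lemma exists_moment_le (hx : IsSolution K x₀ τ ℓ x) (hT : (T : EReal) < lifespan τ) :
    ∃ C : ℝ, 0 ≤ C ∧ ∀ t ∈ Set.Icc 0 T, ∑' k : ℕ+, ((k : ℕ) : ℝ) * |x t k| ≤ C := by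
  have hsub := Icc_subset_lifeInterval hT
  have key : ∃ C : ℝ≥0∞, C ≠ ⊤ ∧ ∀ t ∈ Set.Icc 0 T, momentNorm (x t) ≤ C := by
    refine isCompact_Icc.induction_on (p := fun s => ∃ C : ℝ≥0∞, C ≠ ⊤ ∧
      ∀ t ∈ s, momentNorm (x t) ≤ C) ⟨0, by simp⟩ ?_ ?_ ?_
    · rintro s t hst ⟨C, hC, h⟩
      exact ⟨C, hC, fun r hr => h r (hst hr)⟩
    · rintro s t ⟨C, hC, h⟩ ⟨C', hC', h'⟩
      refine ⟨max C C', (max_lt hC.lt_top hC'.lt_top).ne, fun r hr => ?_⟩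
      rcases hr with hr | hr
      · exact (h r hr).trans (le_max_left _ _)
      · exact (h' r hr).trans (le_max_right _ _)
    · intro s hs
      refine ⟨_, nhdsWithin_mono s hsub
        (hx.eventually_momentNorm_sub_lt (hsub hs) one_pos), momentNorm (x s) + 1,
        ENNReal.add_ne_top.2 ⟨(hx.mem s (hsub hs)).1.1.1.ne, ENNReal.one_ne_top⟩, fun r hr => ?_⟩
      have h := momentNorm_add_le (x s) (x r - x s)
      rw [add_sub_cancel] at h
      exact h.trans (add_le_add le_rfl (le_of_lt hr))
  obtain ⟨C, hC, h⟩ := key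
  refine ⟨C.toReal, ENNReal.toReal_nonneg, fun t ht => ?_⟩
  rw [← toReal_momentNorm (hx.mem t (hsub ht)).1.1.1.ne]
  exact ENNReal.toReal_mono hC (h t ht)

/-- The solution does not vanish, so that its `ℓ¹`-norm is bounded below on compact time
intervals. -/
lemma exists_le_tsum (hx : IsSolution K x₀ τ ℓ x) (hT : (T : EReal) < lifespan τ) :
    ∃ c : ℝ, 0 < c ∧ ∀ t ∈ Set.Icc 0 T, c ≤ ∑' k, x t k := by
  have hsub := Icc_subset_lifeInterval hT
  refine isCompact_Icc.induction_on (p := fun s => ∃ c : ℝ, 0 < c ∧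
    ∀ t ∈ s, c ≤ ∑' k, x t k) ⟨1, by simp⟩ ?_ ?_ ?_
  · rintro s t hst ⟨C, hC, h⟩
    exact ⟨C, hC, fun r hr => h r (hst hr)⟩
  · rintro s t ⟨C, hC, h⟩ ⟨C', hC', h'⟩
    refine ⟨min C C', lt_min hC hC', fun r hr => ?_⟩
    rcases hr with hr | hr
    · exact (min_le_left _ _).trans (h r hr)
    · exact (min_le_right _ _).trans (h' r hr)
  · intro s hs
    have hpos := hx.tsum_pos (hsub hs)
    set c := ∑' k, x s k with hc
    refine ⟨_, Filter.inter_mem (nhdsWithin_mono s hsub (hx.eventually_momentNorm_sub_lt (hsub hs)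
      (ENNReal.ofReal_pos.2 (half_pos hpos)))) self_mem_nhdsWithin, c / 2, half_pos hpos,
      fun r hr => ?_⟩
    have hr1 : momentNorm (x r - x s) < ENNReal.ofReal (c / 2) := hr.1
    have hr2 := hsub hr.2
    have hss := summable_abs_of_moment (hx.summable_moment (hsub hs))
    have hsr := summable_abs_of_moment (hx.summable_moment hr2)
    have hsd : Summable fun k => |(x r - x s) k| :=
      summable_abs_of_moment (summable_moment_sub (hx.summable_moment hr2)
        (hx.summable_moment (hsub hs)))
    have h1 := (l1Norm_le_momentNorm _).trans_lt hr1
    rw [l1Norm_eq hsd] at h1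
    have h2 : ∑' k, |(x r - x s) k| < c / 2 := (ENNReal.ofReal_lt_ofReal_iff (half_pos hpos)).1 h1
    have h3 : c - ∑' k, x r k ≤ ∑' k, |(x r - x s) k| := by
      rw [hc, ← hss.of_abs.tsum_sub hsr.of_abs]
      refine (hss.of_abs.sub hsr.of_abs).tsum_le_tsum (fun k => ?_) hsd
      rw [Pi.sub_apply, abs_sub_comm]
      exact le_abs_self _
    linarith

section Drift

variable {a C : ℝ}

lemma sum_abs_drift_le (hx : IsSolution K x₀ τ ℓ x) (hK : IsCoagulationKernel K)
    (ha : 0 ≤ a) (hKa : ∀ i j : ℕ+, i ≤ j → K i j ≤ a * (i : ℕ))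
    {t : ℝ} (ht : t ∈ lifeInterval τ) (hC : ∑' k : ℕ+, ((k : ℕ) : ℝ) * |x t k| ≤ C)
    (J : Finset ℕ+) : ∑ j ∈ J, |drift K (ℓ t) (x t) j| ≤ 4 * a * C :=
  (sum_abs_drift_le_moment hK.nonneg hK.symm ha hKa (hx.summable_moment ht)
    (fun _ hk => hx.eq_zero_of_lt ht hk) J).trans
    (mul_le_mul_of_nonneg_left hC (by positivity))

/-- The drift is almost everywhere a derivative, hence measurable in time. -/
lemma drift_ae_eq_deriv (hx : IsSolution K x₀ τ ℓ x) (hT : (T : EReal) < lifespan τ) (j : ℕ+) :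
    (fun t => drift K (ℓ t) (x t) j) =ᵐ[volume.restrict (Set.Icc 0 T)]
      deriv fun t => x t j := by
  rw [EventuallyEq, ae_restrict_iff' measurableSet_Icc]
  have h : ∀ᵐ t : ℝ, t ∉ Set.range τ := (Set.countable_range τ).ae_notMem _
  filter_upwards [h] with t ht htT
  exact (hx.ode t ⟨Icc_subset_lifeInterval hT htT, ht⟩ j).deriv.symm

lemma integrableOn_drift (hx : IsSolution K x₀ τ ℓ x) (hK : IsCoagulationKernel K)
    (ha : 0 ≤ a) (hKa : ∀ i j : ℕ+, i ≤ j → K i j ≤ a * (i : ℕ))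
    (hT : (T : EReal) < lifespan τ)
    (hC : ∀ t ∈ Set.Icc 0 T, ∑' k : ℕ+, ((k : ℕ) : ℝ) * |x t k| ≤ C) (j : ℕ+) :
    IntegrableOn (fun t => drift K (ℓ t) (x t) j) (Set.Icc 0 T) := by
  refine Integrable.of_bound (C := 4 * a * C)
    ⟨_, (measurable_deriv _).stronglyMeasurable, hx.drift_ae_eq_deriv hT j⟩ ?_
  refine (ae_restrict_iff' measurableSet_Icc).2 (Eventually.of_forall fun t ht => ?_)
  have h := hx.sum_abs_drift_le hK ha hKa (Icc_subset_lifeInterval hT ht) (hC t ht) {j}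
  simpa using h

/-- The solution satisfies the integrated form of the equation across the jump times of the minimal
size. -/
lemma sub_eq_integral_drift (hx : IsSolution K x₀ τ ℓ x) (hK : IsCoagulationKernel K)
    (ha : 0 ≤ a) (hKa : ∀ i j : ℕ+, i ≤ j → K i j ≤ a * (i : ℕ))
    (hT : (T : EReal) < lifespan τ)
    (hC : ∀ t ∈ Set.Icc 0 T, ∑' k : ℕ+, ((k : ℕ) : ℝ) * |x t k| ≤ C) (j : ℕ+)
    {s t : ℝ} (hs : 0 ≤ s) (hst : s ≤ t) (ht : t ≤ T) :
    x t j - x s j = ∫ r in s..t, drift K (ℓ r) (x r) j := by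
  have hsub := Icc_subset_lifeInterval hT
  have hss : Set.Icc s t ⊆ Set.Icc 0 T := Set.Icc_subset_Icc hs ht
  symm
  refine integral_eq_of_hasDerivAt_off_countable_of_le (fun r => x r j) _ hst
    (Set.countable_range τ) ((hx.continuousOn_apply j).mono (hss.trans hsub)) ?_ ?_
  · intro r hr
    exact hx.ode r ⟨hsub (hss (Set.Ioo_subset_Icc_self hr.1)), hr.2⟩ j
  · rw [intervalIntegrable_iff_integrableOn_Icc_of_le hst]
    exact (hx.integrableOn_drift hK ha hKa hT hC j).mono_set hss

end Drift

end IsSolution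

end Solution

/-! ### Comparison of trajectories through successive stages -/

section StageComparison

/-- Abstract comparison of two trajectories which go through successive stages `p` and `q`.
The function `h` measures their distance and `Ψ` bounds its growth rate. The rate is bounded by `B`;
it is controlled by `h` itself while the two stages agree. While they disagree, the component
which belongs to the lower stage is being depleted at a rate at least `c₁`, provided that `h` does
not exceed `c₂`: this bounds the length of a period of disagreement by the value of `h` at its
beginning. -/
structure StageComparison (T B L E c₁ c₂ ε : ℝ) (h Ψ : ℝ → ℝ) (p q : ℝ → ℕ+) : Prop where
  initial : h 0 ≤ ε
  continuousOn : ContinuousOn h (Set.Icc 0 T)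
  growth : ∀ s t c, 0 ≤ s → s ≤ t → t ≤ T → (∀ r ∈ Set.Ioo s t, Ψ r ≤ c) →
    h t ≤ h s + c * (t - s)
  rate_le : ∀ r ∈ Set.Icc 0 T, Ψ r ≤ B
  rate_le_of_eq : ∀ r ∈ Set.Icc 0 T, p r = q r → Ψ r ≤ L * h r + L * ε
  mono_left : MonotoneOn p (Set.Icc 0 T)
  mono_right : MonotoneOn q (Set.Icc 0 T)
  left_behind : ∀ r s, 0 ≤ r → r ≤ s → s ≤ T → (∀ u ∈ Set.Icc r s, p u = p s ∧ p u < q u) →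
    (∀ u ∈ Set.Icc r s, h u ≤ c₂) → c₁ * (s - r) ≤ h r + E * ε
  right_behind : ∀ r s, 0 ≤ r → r ≤ s → s ≤ T → (∀ u ∈ Set.Icc r s, q u = q s ∧ q u < p u) →
    (∀ u ∈ Set.Icc r s, h u ≤ c₂) → c₁ * (s - r) ≤ h r + E * ε

namespace StageComparison

variable {T B L E c₁ c₂ ε : ℝ} {h Ψ : ℝ → ℝ} {p q : ℝ → ℕ+}

lemma growth_le (H : StageComparison T B L E c₁ c₂ ε h Ψ p q) {s t : ℝ} (hs : 0 ≤ s)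
    (hst : s ≤ t) (ht : t ≤ T) : h t ≤ h s + B * (t - s) :=
  H.growth s t B hs hst ht fun r hr => H.rate_le r ⟨hs.trans hr.1.le, hr.2.le.trans ht⟩

/-- Grönwall's inequality on a period of agreement. -/
lemma le_of_agree (H : StageComparison T B L E c₁ c₂ ε h Ψ p q) (hL : 0 < L) (hε : 0 ≤ ε)
    {D s t : ℝ} (hD : 0 ≤ D) (hs : 0 ≤ s) (hst : s ≤ t) (ht : t ≤ T)
    (heq : ∀ r ∈ Set.Ioo s t, p r = q r) (hDs : h s ≤ D * ε) :
    h t ≤ (D + 1) * Real.exp (L * T) * ε := by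
  rcases hst.eq_or_lt with rfl | hst'
  · have h1 : 1 ≤ Real.exp (L * T) := Real.one_le_exp (mul_nonneg hL.le (hs.trans ht))
    have h2 : D * ε ≤ (D + 1) * Real.exp (L * T) * ε :=
      mul_le_mul_of_nonneg_right (by nlinarith) hε
    exact hDs.trans h2
  have hcont : ContinuousOn h (Set.Icc s t) := H.continuousOn.mono (Set.Icc_subset_Icc hs ht)
  have hG := le_gronwallBound_of_liminf_deriv_right_le (f := h)
    (f' := fun r => L * h r + L * ε) (δ := D * ε) (K := L) (ε := L * ε) (a := s) (b := t)
    hcont ?_ hDs (fun r _ => le_rfl) t ⟨hst, le_rfl⟩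
  · rw [gronwallBound_of_K_ne_0 hL.ne'] at hG
    have h0 : L * ε / L = ε := by field_simp
    rw [h0] at hG
    have h1 : Real.exp (L * (t - s)) ≤ Real.exp (L * T) :=
      Real.exp_le_exp.2 (mul_le_mul_of_nonneg_left (by linarith) hL.le)
    nlinarith [mul_le_mul_of_nonneg_left h1 (mul_nonneg hD hε), mul_le_mul_of_nonneg_left h1 hε]
  · intro r hr c hc
    have hcr : ContinuousWithinAt (fun u => L * h u + L * ε) (Set.Icc s t) r :=
      ((continuousOn_const.mul hcont).add continuousOn_const) r ⟨hr.1, hr.2.le⟩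
    have hlt : ∀ᶠ u in 𝓝[Set.Icc s t] r, L * h u + L * ε < (L * h r + L * ε + c) / 2 :=
      hcr.eventually_lt_const (by linarith)
    obtain ⟨d, hd, hball⟩ := Metric.mem_nhdsWithin_iff.1 hlt
    refine Eventually.frequently ?_
    have hmem : Set.Ioo r (min t (r + d)) ∈ 𝓝[>] r :=
      Ioo_mem_nhdsGT (lt_min hr.2 (by linarith))
    filter_upwards [hmem] with z hz
    have hzt : z < t := hz.2.trans_le (min_le_left _ _)
    have hzd : z < r + d := hz.2.trans_le (min_le_right _ _)
    have hg := H.growth r z ((L * h r + L * ε + c) / 2) (hs.trans hr.1) hz.1.le (hzt.le.trans ht) ?_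
    · rw [inv_mul_lt_iff₀ (by linarith [hz.1])]
      have : (L * h r + L * ε + c) / 2 < c := by linarith
      nlinarith [hz.1]
    · intro u hu
      have hus : s < u := hr.1.trans_lt hu.1
      have hut : u < t := hu.2.trans hzt
      refine (H.rate_le_of_eq u ⟨hs.trans hus.le, hut.le.trans ht⟩ (heq u ⟨hus, hut⟩)).trans ?_
      refine le_of_lt (hball ⟨?_, hus.le, hut.le⟩)
      rw [Metric.mem_ball, Real.dist_eq, abs_lt]
      constructor <;> linarith [hu.1, hu.2]

/-- A period of disagreement is short, so that it increases `h` by a bounded factor only. -/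
lemma le_of_disagree (H : StageComparison T B L E c₁ c₂ ε h Ψ p q) (hB : 0 < B) (hc₁ : 0 < c₁)
    (hε : 0 ≤ ε) (hE : 0 ≤ E) {D a s : ℝ} (hD : 0 ≤ D) (ha : 0 ≤ a) (has : a ≤ s) (hs : s ≤ T)
    (hne : (∀ u ∈ Set.Ioc a s, p u = p s ∧ p u < q u) ∨ ∀ u ∈ Set.Ioc a s, q u = q s ∧ q u < p u)
    (hDa : h a ≤ D * ε) (hsmall : D * ε ≤ c₂ / 2) (hsmall' : (D + E) * ε / c₁ < c₂ / (2 * B)) :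
    h s ≤ (D + B * (D + E) / c₁) * ε := by
  set η := c₂ / (2 * B) with hη
  have hBη : B * η = c₂ / 2 := by rw [hη]; field_simp
  have hη0 : 0 < η := lt_of_le_of_lt (by positivity) hsmall'
  set m := min s (a + η) with hm
  have ham : a ≤ m := le_min has (by linarith)
  have hms : m ≤ s := min_le_left _ _
  have hmη : m - a ≤ η := by linarith [min_le_right s (a + η)]
  -- before time `m` the function `h` cannot exceed `c₂`, so that the depletion is effective
  have hle : ∀ r, a < r → r ≤ m → c₁ * (m - r) ≤ D * ε + B * (r - a) + E * ε := by
    intro r har hrm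
    have h1 : ∀ u ∈ Set.Icc r m, h u ≤ c₂ := by
      intro u hu
      have h2 := H.growth_le ha (har.le.trans hu.1) ((hu.2.trans hms).trans hs)
      have h3 : B * (u - a) ≤ B * η := mul_le_mul_of_nonneg_left (by linarith [hu.2]) hB.le
      linarith
    have h2 : c₁ * (m - r) ≤ h r + E * ε := by
      have hmem : ∀ u ∈ Set.Icc r m, u ∈ Set.Ioc a s := fun u hu =>
        ⟨har.trans_le hu.1, hu.2.trans hms⟩
      have hmm : m ∈ Set.Ioc a s := hmem m ⟨hrm, le_rfl⟩
      rcases hne with hne | hne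
      · refine H.left_behind r m (ha.trans har.le) hrm (hms.trans hs) (fun u hu => ?_) h1
        exact ⟨(hne u (hmem u hu)).1.trans (hne m hmm).1.symm, (hne u (hmem u hu)).2⟩
      · refine H.right_behind r m (ha.trans har.le) hrm (hms.trans hs) (fun u hu => ?_) h1
        exact ⟨(hne u (hmem u hu)).1.trans (hne m hmm).1.symm, (hne u (hmem u hu)).2⟩
    have h3 := H.growth_le ha har.le ((hrm.trans hms).trans hs)
    linarith
  have hlen : c₁ * (m - a) ≤ (D + E) * ε := by
    rcases ham.eq_or_lt with h0 | h0
    · rw [← h0, sub_self, mul_zero]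
      positivity
    · by_contra! hcon
      set d := c₁ * (m - a) - (D + E) * ε with hd
      have hd0 : 0 < d := by linarith
      set y := min (m - a) (d / (2 * (c₁ + B))) with hy
      have hy0 : 0 < y := lt_min (by linarith) (by positivity)
      have h1 := hle (a + y) (by linarith) (by linarith [min_le_left (m - a) (d / (2 * (c₁ + B)))])
      have h2 : (c₁ + B) * y ≤ d / 2 := by
        have h3 := mul_le_mul_of_nonneg_left (min_le_right (m - a) (d / (2 * (c₁ + B))))
          (by positivity : 0 ≤ c₁ + B)
        have h4 : (c₁ + B) * (d / (2 * (c₁ + B))) = d / 2 := by field_simp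
        linarith
      nlinarith
  have hlen' : m - a ≤ (D + E) * ε / c₁ := by
    rw [le_div_iff₀ hc₁]
    linarith
  have hmeq : m = s := by
    rcases le_or_gt s (a + η) with h1 | h1
    · exact min_eq_left h1
    · have : m = a + η := min_eq_right h1.le
      linarith
  rw [hmeq] at hlen'
  have h1 := H.growth_le ha has hs
  have h2 := mul_le_mul_of_nonneg_left hlen' hB.le
  have h3 : B * ((D + E) * ε / c₁) = B * (D + E) / c₁ * ε := by ring
  linarith

/-- The distance stays of order `ε` through any bounded number of stages. -/
theorem exists_bound_of_stage_le (hT : 0 ≤ T) (hB : 0 < B) (hL : 0 < L) (hE : 0 ≤ E) (hc₁ : 0 < c₁)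
    (hc₂ : 0 < c₂) (n : ℕ) :
    ∃ D ε₀ : ℝ, 1 ≤ D ∧ 0 < ε₀ ∧ ∀ ε h Ψ p q, 0 < ε → ε ≤ ε₀ →
      StageComparison T B L E c₁ c₂ ε h Ψ p q →
      ∀ s ∈ Set.Icc 0 T, ((min (p s) (q s) : ℕ+) : ℕ) ≤ n → h s ≤ D * ε := by
  induction n with
  | zero =>
    refine ⟨1, 1, le_rfl, one_pos, fun ε h Ψ p q _ _ _ s _ hs => ?_⟩
    exact absurd hs (not_le.2 (PNat.pos _))
  | succ n ih =>
    obtain ⟨D, ε₀, hD, hε₀, ih⟩ := ih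
    set D' := (D + 1) * Real.exp (L * T) with hD'
    have hexp : 1 ≤ Real.exp (L * T) := Real.one_le_exp (mul_nonneg hL.le hT)
    have hDD' : D ≤ D' := by nlinarith
    have hD'0 : 0 < D' := by linarith
    have hincr : 0 ≤ B * (D' + E) / c₁ := by positivity
    refine ⟨D' + B * (D' + E) / c₁,
      min ε₀ (min (c₂ / 2 / D') (c₂ / (2 * B) * c₁ / (2 * (D' + E)))), by linarith,
      by positivity, fun ε h Ψ p q hε hεle H s hs hstage => ?_⟩
    have hε1 : ε ≤ ε₀ := hεle.trans (min_le_left _ _)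
    have hε2 : D' * ε ≤ c₂ / 2 := by
      have := hεle.trans ((min_le_right _ _).trans (min_le_left _ _))
      rw [le_div_iff₀ hD'0] at this
      linarith
    have hε3 : (D' + E) * ε / c₁ < c₂ / (2 * B) := by
      have h1 := hεle.trans ((min_le_right _ _).trans (min_le_right _ _))
      rw [le_div_iff₀ (by positivity)] at h1
      rw [div_lt_iff₀ hc₁]
      have : 0 < (D' + E) * ε := by positivity
      nlinarith
    have hmono : MonotoneOn (fun r => min (p r) (q r)) (Set.Icc 0 T) := fun u hu v hv huv =>
      min_le_min (H.mono_left hu hv huv) (H.mono_right hu hv huv)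
    -- `s₀` is the end of the earlier stages
    set A : Set ℝ := insert 0 {r | r ∈ Set.Icc 0 s ∧ ((min (p r) (q r) : ℕ+) : ℕ) ≤ n} with hA
    have hAsub : A ⊆ Set.Icc 0 s := by
      rintro r (rfl | hr)
      · exact ⟨le_rfl, hs.1⟩
      · exact hr.1
    have hsT : Set.Icc 0 s ⊆ Set.Icc 0 T := Set.Icc_subset_Icc le_rfl hs.2
    have hAne : A.Nonempty := ⟨0, Set.mem_insert _ _⟩
    have hAbdd : BddAbove A := ⟨s, fun r hr => (hAsub hr).2⟩
    set s₀ := sSup A with hs₀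
    have hcl : IsClosed {r | r ∈ Set.Icc 0 s ∧ h r ≤ D * ε} := by
      have := (H.continuousOn.mono hsT).preimage_isClosed_of_isClosed isClosed_Icc
        (isClosed_Iic (a := D * ε))
      exact this
    have hAh : A ⊆ {r | r ∈ Set.Icc 0 s ∧ h r ≤ D * ε} := by
      intro r hr
      refine ⟨hAsub hr, ?_⟩
      rcases hr with rfl | hr
      · have := H.initial
        nlinarith
      · exact ih ε h Ψ p q hε hε1 H r (hsT hr.1) hr.2
    have hs₀mem : s₀ ∈ Set.Icc 0 s ∧ h s₀ ≤ D * ε :=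
      closure_minimal hAh hcl (csSup_mem_closure hAne hAbdd)
    have hlater : ∀ r ∈ Set.Ioc s₀ s, min (p r) (q r) = min (p s) (q s) := by
      intro r hr
      have hr0 : r ∈ Set.Icc 0 s := ⟨hs₀mem.1.1.trans hr.1.le, hr.2⟩
      have h1 : n < ((min (p r) (q r) : ℕ+) : ℕ) := by
        by_contra! hcon
        exact absurd (le_csSup hAbdd (Or.inr ⟨hr0, hcon⟩)) (not_le.2 hr.1)
      have h2 : min (p r) (q r) ≤ min (p s) (q s) := hmono (hsT hr0) hs hr.2
      refine le_antisymm h2 ?_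
      rw [← PNat.coe_le_coe]
      exact hstage.trans h1
    -- `a` is the beginning of the period of disagreement
    set F : Set ℝ := insert s {r | r ∈ Set.Ioc s₀ s ∧ p r ≠ q r} with hF
    have hFsub : ∀ r ∈ F, s₀ ≤ r ∧ r ≤ s := by
      rintro r (rfl | hr)
      · exact ⟨hs₀mem.1.2, le_rfl⟩
      · exact ⟨hr.1.1.le, hr.1.2⟩
    have hFne : F.Nonempty := ⟨s, Set.mem_insert _ _⟩
    have hFbdd : BddBelow F := ⟨s₀, fun r hr => (hFsub r hr).1⟩
    set a := sInf F with ha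
    have hs₀a : s₀ ≤ a := le_csInf hFne fun r hr => (hFsub r hr).1
    have has : a ≤ s := csInf_le hFbdd (Set.mem_insert _ _)
    have hagree : ∀ r ∈ Set.Ioo s₀ a, p r = q r := by
      intro r hr
      by_contra hcon
      exact absurd (csInf_le hFbdd (Or.inr ⟨⟨hr.1, hr.2.le.trans has⟩, hcon⟩)) (not_le.2 hr.2)
    have hha : h a ≤ D' * ε := H.le_of_agree hL hε.le (by linarith) hs₀mem.1.1 hs₀a
      (has.trans hs.2) hagree hs₀mem.2
    rcases has.eq_or_lt with has' | has'
    · rw [← has']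
      have : 0 ≤ B * (D' + E) / c₁ * ε := mul_nonneg hincr hε.le
      linarith
    have hdis : ∀ u ∈ Set.Ioc a s, p u ≠ q u := by
      intro u hu heq
      obtain ⟨r, hrF, hru⟩ := exists_lt_of_csInf_lt hFne hu.1
      have hr : r ∈ Set.Ioc s₀ s ∧ p r ≠ q r := by
        rcases hrF with rfl | hr
        · exact absurd hu.2 (not_le.2 hru)
        · exact hr
      have hr0 : r ∈ Set.Icc 0 T := ⟨hs₀mem.1.1.trans hr.1.1.le, hr.1.2.trans hs.2⟩
      have hu0 : u ∈ Set.Icc 0 T := ⟨hr0.1.trans hru.le, hu.2.trans hs.2⟩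
      have h1 := (hlater r hr.1).trans (hlater u ⟨hr.1.1.trans hru, hu.2⟩).symm
      rw [heq, min_self] at h1
      have h2 := H.mono_left hr0 hu0 hru.le
      have h3 := H.mono_right hr0 hu0 hru.le
      rw [heq] at h2
      apply hr.2
      rcases min_choice (p r) (q r) with h4 | h4
      · have h5 := min_eq_left_iff.1 h4
        rw [h4] at h1
        exact le_antisymm h5 (h3.trans h1.ge)
      · have h5 := min_eq_right_iff.1 h4
        rw [h4] at h1
        exact le_antisymm (h2.trans h1.ge) h5
    refine H.le_of_disagree hB hc₁ hε.le hE hD'0.le (hs₀mem.1.1.trans hs₀a) has hs.2 ?_ hha hε2 hε3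
    have hsmem : s ∈ Set.Ioc a s := ⟨has', le_rfl⟩
    have hT0 : ∀ u ∈ Set.Ioc a s, u ∈ Set.Icc 0 T := fun u hu =>
      ⟨(hs₀mem.1.1.trans hs₀a).trans hu.1.le, hu.2.trans hs.2⟩
    have hmin : ∀ u ∈ Set.Ioc a s, min (p u) (q u) = min (p s) (q s) := fun u hu =>
      hlater u ⟨hs₀a.trans_lt hu.1, hu.2⟩
    rcases lt_or_gt_of_ne (hdis s hsmem) with hlt | hlt
    · left
      intro u hu
      have h1 := hmin u hu
      have h2 := H.mono_left (hT0 u hu) hs hu.2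
      rw [min_eq_left hlt.le] at h1
      have h3 : p u = p s := le_antisymm h2 (h1 ▸ min_le_left _ _)
      exact ⟨h3, lt_of_le_of_ne (h3 ▸ h1 ▸ min_le_right _ _) (hdis u hu)⟩
    · right
      intro u hu
      have h1 := hmin u hu
      have h2 := H.mono_right (hT0 u hu) hs hu.2
      rw [min_eq_right hlt.le] at h1
      have h3 : q u = q s := le_antisymm h2 (h1 ▸ min_le_right _ _)
      exact ⟨h3, lt_of_le_of_ne (h3 ▸ h1 ▸ min_le_left _ _) (hdis u hu).symm⟩

end StageComparison

end StageComparison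

/-! ### Stability of the deterministic equation -/

section Stability

/-- `y` is an approximate solution of the min-driven coagulation equation on `[0, T]`, with minimal
size `q` and drift `β`: up to errors of order `ε` in the first `R` components, `y` is the integral
of `β`, and `β` is the vector field of the equation evaluated along `y`. -/
structure IsApproxSolution (K : ℕ+ → ℕ+ → ℝ) (T a ε : ℝ) (R : ℕ+) (q : ℝ → ℕ+)
    (y β : ℝ → ℕ+ → ℝ) : Prop where
  nonneg : ∀ t ∈ Set.Icc 0 T, ∀ j, 0 ≤ y t j
  eq_zero : ∀ t ∈ Set.Icc 0 T, ∀ j, j < q t → y t j = 0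
  summable : ∀ t ∈ Set.Icc 0 T, Summable fun k : ℕ+ => ((k : ℕ) : ℝ) * |y t k|
  moment_le : ∀ t ∈ Set.Icc 0 T, ∑' k : ℕ+, ((k : ℕ) : ℝ) * |y t k| ≤ 1
  mono : MonotoneOn q (Set.Icc 0 T)
  integrable : ∀ j, IntegrableOn (fun t => β t j) (Set.Icc 0 T)
  drift_le : ∀ t ∈ Set.Icc 0 T, ∑ j ∈ Finset.Iic R, |β t j| ≤ 7 * a
  drift_sub_le : ∀ t ∈ Set.Icc 0 T,
    ∑ j ∈ Finset.Iic R, |β t j - drift K (q t) (y t) j| ≤ 3 * a * (q t : ℕ) * ε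
  error_le : ∀ t ∈ Set.Icc 0 T,
    ∑ j ∈ Finset.Iic R, |y t j - y 0 j - ∫ r in (0 : ℝ)..t, β r j| ≤ 3 * ε

variable {K : ℕ+ → ℕ+ → ℝ} {x₀ : ℕ+ → ℝ} {τ : ℕ → ℝ} {ℓ : ℝ → ℕ+} {x : ℝ → ℕ+ → ℝ} {T a : ℝ}

lemma exists_kernel_lower_bound (hK : IsCoagulationKernel K) (n : ℕ+) :
    ∃ δ : ℝ, 0 < δ ∧ ∀ i j, i ≤ n → i ≤ j → δ ≤ K i j := by
  have hne : (Finset.Iic n).Nonempty := ⟨n, by simp⟩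
  refine ⟨(Finset.Iic n).inf' hne fun i => ⨅ j : Set.Ici i, K i j, ?_, fun i j hi hij => ?_⟩
  · rw [Finset.lt_inf'_iff]
    exact fun i _ => hK.inf_pos i
  · refine (Finset.inf'_le _ (Finset.mem_Iic.2 hi)).trans ?_
    exact ciInf_le ⟨0, by rintro _ ⟨k, rfl⟩; exact hK.nonneg _ _⟩ (⟨j, hij⟩ : Set.Ici i)

/-- The distance of the first components of an exact solution and of the integrated drift of an
approximate solution. -/
noncomputable def compDist (R : ℕ+) (x y β : ℝ → ℕ+ → ℝ) (t : ℝ) : ℝ :=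
  ∑ j ∈ Finset.Iic R, |x t j - y 0 j - ∫ r in (0 : ℝ)..t, β r j|

variable {ε C c δ : ℝ} {R n : ℕ+} {q : ℝ → ℕ+} {y β : ℝ → ℕ+ → ℝ}

lemma compDist_nonneg (R : ℕ+) (x y β : ℝ → ℕ+ → ℝ) (t : ℝ) : 0 ≤ compDist R x y β t :=
  Finset.sum_nonneg fun _ _ => abs_nonneg _

namespace IsApproxSolution

lemma sum_abs_sub_le (hy : IsApproxSolution K T a ε R q y β) {t : ℝ} (ht : t ∈ Set.Icc 0 T) :
    ∑ j ∈ Finset.Iic R, |x t j - y t j| ≤ compDist R x y β t + 3 * ε := by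
  refine le_trans ?_ (add_le_add le_rfl (hy.error_le t ht))
  rw [compDist, ← Finset.sum_add_distrib]
  refine Finset.sum_le_sum fun j _ => ?_
  have := abs_sub (x t j - y 0 j - ∫ r in (0 : ℝ)..t, β r j)
    (y t j - y 0 j - ∫ r in (0 : ℝ)..t, β r j)
  refine le_trans (le_of_eq ?_) this
  congr 1
  ring

lemma abs_sub_le (hy : IsApproxSolution K T a ε R q y β) {t : ℝ} (ht : t ∈ Set.Icc 0 T) {j : ℕ+}
    (hj : j ≤ R) : |x t j - y t j| ≤ compDist R x y β t + 3 * ε :=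
  (Finset.single_le_sum (f := fun j => |x t j - y t j|) (fun _ _ => abs_nonneg _)
    (Finset.mem_Iic.2 hj)).trans (hy.sum_abs_sub_le ht)

lemma tsum_abs_sub_le (hy : IsApproxSolution K T a ε R q y β) (hx : IsSolution K x₀ τ ℓ x)
    (hT : (T : EReal) < lifespan τ)
    (hC : ∀ t ∈ Set.Icc 0 T, ∑' k : ℕ+, ((k : ℕ) : ℝ) * |x t k| ≤ C) (hC0 : 0 ≤ C)
    (hR : 1 / ((R : ℕ) : ℝ) ≤ ε) {t : ℝ} (ht : t ∈ Set.Icc 0 T) :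
    ∑' k, |(x t - y t) k| ≤ compDist R x y β t + (C + 4) * ε := by
  have hxs := hx.summable_moment (Icc_subset_lifeInterval hT ht)
  have h1 := tsum_abs_le_sum_add (summable_moment_sub hxs (hy.summable t ht)) R
  have h2 := (tsum_moment_sub_le hxs (hy.summable t ht)).trans
    (add_le_add (hC t ht) (hy.moment_le t ht))
  have h3 := hy.sum_abs_sub_le (x := x) ht
  have h4 : (∑' k : ℕ+, ((k : ℕ) : ℝ) * |(x t - y t) k|) / (R : ℕ) ≤ (C + 1) * ε := by
    rw [div_eq_mul_one_div]
    exact mul_le_mul h2 hR (by positivity) (by linarith)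
  simp only [Pi.sub_apply] at h1 h4 ⊢
  linarith

lemma continuousOn_compDist (hy : IsApproxSolution K T a ε R q y β) (hx : IsSolution K x₀ τ ℓ x)
    (hT0 : 0 ≤ T) (hT : (T : EReal) < lifespan τ) :
    ContinuousOn (compDist R x y β) (Set.Icc 0 T) := by
  refine continuousOn_finsetSum _ fun j _ => ContinuousOn.abs ?_
  refine (((hx.continuousOn_apply j).mono (Icc_subset_lifeInterval hT)).sub
    continuousOn_const).sub ?_
  have h := intervalIntegral.continuousOn_primitive_interval (μ := volume) (a := (0 : ℝ)) (b := T)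
    (f := fun t => β t j) (by rw [Set.uIcc_of_le hT0]; exact hy.integrable j)
  rwa [Set.uIcc_of_le hT0] at h

lemma intervalIntegrable_drift (hy : IsApproxSolution K T a ε R q y β) (j : ℕ+) {s t : ℝ}
    (hs : 0 ≤ s) (hst : s ≤ t) (ht : t ≤ T) :
    IntervalIntegrable (fun r => β r j) volume s t := by
  rw [intervalIntegrable_iff_integrableOn_Icc_of_le hst]
  exact (hy.integrable j).mono_set (Set.Icc_subset_Icc hs ht)

lemma compDist_le_add (hy : IsApproxSolution K T a ε R q y β) (hx : IsSolution K x₀ τ ℓ x)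
    (hK : IsCoagulationKernel K) (ha : 0 ≤ a) (hKa : ∀ i j : ℕ+, i ≤ j → K i j ≤ a * (i : ℕ))
    (hT : (T : EReal) < lifespan τ)
    (hC : ∀ t ∈ Set.Icc 0 T, ∑' k : ℕ+, ((k : ℕ) : ℝ) * |x t k| ≤ C)
    {s t b : ℝ} (hs : 0 ≤ s) (hst : s ≤ t) (ht : t ≤ T)
    (hb : ∀ r ∈ Set.Ioo s t, ∑ j ∈ Finset.Iic R, |drift K (ℓ r) (x r) j - β r j| ≤ b) :
    compDist R x y β t ≤ compDist R x y β s + b * (t - s) := by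
  have hxi : ∀ j, IntervalIntegrable (fun r => drift K (ℓ r) (x r) j) volume s t := fun j => by
    rw [intervalIntegrable_iff_integrableOn_Icc_of_le hst]
    exact (hx.integrableOn_drift hK ha hKa hT hC j).mono_set (Set.Icc_subset_Icc hs ht)
  have hyi : ∀ j, IntervalIntegrable (fun r => β r j) volume s t := fun j =>
    hy.intervalIntegrable_drift j hs hst ht
  have h1 : ∀ j, |x t j - y 0 j - ∫ r in (0 : ℝ)..t, β r j| ≤
      |x s j - y 0 j - ∫ r in (0 : ℝ)..s, β r j| +
        ∫ r in s..t, |drift K (ℓ r) (x r) j - β r j| := by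
    intro j
    have h2 := hx.sub_eq_integral_drift hK ha hKa hT hC j hs hst ht
    have h3 := intervalIntegral.integral_add_adjacent_intervals
      (hy.intervalIntegrable_drift j le_rfl hs (hst.trans ht)) (hyi j)
    have h4 : x t j - y 0 j - ∫ r in (0 : ℝ)..t, β r j =
        (x s j - y 0 j - ∫ r in (0 : ℝ)..s, β r j) +
          ∫ r in s..t, (drift K (ℓ r) (x r) j - β r j) := by
      rw [intervalIntegral.integral_sub (hxi j) (hyi j), ← h3, ← h2]
      ring
    rw [h4]
    exact (abs_add_le _ _).trans
      (add_le_add le_rfl (intervalIntegral.abs_integral_le_integral_abs hst))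
  refine (Finset.sum_le_sum fun j _ => h1 j).trans ?_
  rw [Finset.sum_add_distrib]
  refine add_le_add le_rfl ?_
  rw [← intervalIntegral.integral_finsetSum fun j _ => ((hxi j).sub (hyi j)).abs]
  have h5 : ∫ r in s..t, ∑ j ∈ Finset.Iic R, |drift K (ℓ r) (x r) j - β r j| ≤
      ∫ _ in s..t, b := by
    refine intervalIntegral.integral_mono_on_of_le_Ioo hst ?_ intervalIntegrable_const hb
    have h6 := IntervalIntegrable.sum (Finset.Iic R) fun j _ => ((hxi j).sub (hyi j)).abs
    refine h6.congr fun r _ => ?_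
    simp
  refine h5.trans (le_of_eq ?_)
  rw [intervalIntegral.integral_const, smul_eq_mul, mul_comm]

lemma rate_le (hy : IsApproxSolution K T a ε R q y β) (hx : IsSolution K x₀ τ ℓ x)
    (hK : IsCoagulationKernel K) (ha : 0 ≤ a) (hKa : ∀ i j : ℕ+, i ≤ j → K i j ≤ a * (i : ℕ))
    (hT : (T : EReal) < lifespan τ)
    (hC : ∀ t ∈ Set.Icc 0 T, ∑' k : ℕ+, ((k : ℕ) : ℝ) * |x t k| ≤ C)
    {r : ℝ} (hr : r ∈ Set.Icc 0 T) :
    ∑ j ∈ Finset.Iic R, |drift K (ℓ r) (x r) j - β r j| ≤ 4 * a * C + 7 * a := by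
  refine le_trans ?_ (add_le_add
    (hx.sum_abs_drift_le hK ha hKa (Icc_subset_lifeInterval hT hr) (hC r hr) (Finset.Iic R))
    (hy.drift_le r hr))
  rw [← Finset.sum_add_distrib]
  exact Finset.sum_le_sum fun j _ => abs_sub _ _

/-- While the minimal sizes agree, the vector field is Lipschitz continuous in `ℓ¹`. -/
lemma rate_le_of_eq (hy : IsApproxSolution K T a ε R q y β) (hx : IsSolution K x₀ τ ℓ x)
    (hK : IsCoagulationKernel K) (ha : 0 ≤ a) (hKa : ∀ i j : ℕ+, i ≤ j → K i j ≤ a * (i : ℕ))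
    (hT : (T : EReal) < lifespan τ)
    (hC : ∀ t ∈ Set.Icc 0 T, ∑' k : ℕ+, ((k : ℕ) : ℝ) * |x t k| ≤ C) (hC0 : 0 ≤ C)
    (hR : 1 / ((R : ℕ) : ℝ) ≤ ε) (hε : 0 ≤ ε)
    {r : ℝ} (hr : r ∈ Set.Icc 0 T) (hq : ℓ r = q r) (hn : ℓ r ≤ n) :
    ∑ j ∈ Finset.Iic R, |drift K (ℓ r) (x r) j - β r j| ≤
      4 * a * (n : ℕ) * (C + 5) * compDist R x y β r + 4 * a * (n : ℕ) * (C + 5) * ε := by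
  have hrl := Icc_subset_lifeInterval hT hr
  have hxs := hx.summable_moment hrl
  have hn' : ((ℓ r : ℕ) : ℝ) ≤ (n : ℕ) := by exact_mod_cast hn
  have h1 : ∑ j ∈ Finset.Iic R, |drift K (ℓ r) (x r) j - β r j| ≤
      ∑ j ∈ Finset.Iic R, |drift K (ℓ r) (x r - y r) j| +
        ∑ j ∈ Finset.Iic R, |β r j - drift K (q r) (y r) j| := by
    rw [← Finset.sum_add_distrib]
    refine Finset.sum_le_sum fun j _ => ?_
    rw [drift_sub hK.nonneg (hKa _) (summable_abs_of_moment hxs)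
      (summable_abs_of_moment (hy.summable r hr)), ← hq]
    refine le_trans (le_of_eq ?_) (abs_sub _ _)
    congr 1
    ring
  have h2 := MinDriven.sum_abs_drift_le hK.nonneg hK.symm (hKa (ℓ r))
    (summable_abs_of_moment (summable_moment_sub hxs (hy.summable r hr))) (fun k hk => by
      rw [Pi.sub_apply, hx.eq_zero_of_lt hrl hk, hy.eq_zero r hr k (hq ▸ hk), sub_zero])
    (Finset.Iic R)
  have h3 := hy.tsum_abs_sub_le hx hT hC hC0 hR hr
  have h4 := hy.drift_sub_le r hr
  rw [← hq] at h4
  have hd := compDist_nonneg R x y β r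
  have h5 : 4 * (a * ((ℓ r : ℕ) : ℝ)) * ∑' k, |(x r - y r) k| ≤
      4 * (a * (n : ℕ)) * (compDist R x y β r + (C + 4) * ε) :=
    mul_le_mul (by gcongr) h3 (tsum_nonneg fun _ => abs_nonneg _) (by positivity)
  have h6 : 3 * a * ((ℓ r : ℕ) : ℝ) * ε ≤ 3 * a * (n : ℕ) * ε := by gcongr
  have h7 : 0 ≤ a * (n : ℕ) * (C + 4) * compDist R x y β r := by positivity
  have h8 : 0 ≤ a * (n : ℕ) * ε := by positivity
  rw [← hq] at h1
  nlinarith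

/-- While the minimal size of the approximate solution is the larger one, the component `ℓ s` of the
exact solution is bounded by the distance of the two and decreases at the rate `δ * c` or more. -/
lemma left_behind (hy : IsApproxSolution K T a ε R q y β) (hx : IsSolution K x₀ τ ℓ x)
    (hK : IsCoagulationKernel K) (ha : 0 ≤ a) (hKa : ∀ i j : ℕ+, i ≤ j → K i j ≤ a * (i : ℕ))
    (hT : (T : EReal) < lifespan τ)
    (hC : ∀ t ∈ Set.Icc 0 T, ∑' k : ℕ+, ((k : ℕ) : ℝ) * |x t k| ≤ C)
    (hc : ∀ t ∈ Set.Icc 0 T, c ≤ ∑' k, x t k) (hδ0 : 0 ≤ δ)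
    (hδ : ∀ i j, i ≤ n → i ≤ j → δ ≤ K i j)
    (hn : n ≤ R) {r s : ℝ} (hr : 0 ≤ r) (hrs : r ≤ s) (hs : s ≤ T) (hsn : ℓ s ≤ n)
    (hlag : ∀ u ∈ Set.Icc r s, ℓ u = ℓ s ∧ ℓ u < q u) :
    δ * c * (s - r) ≤ compDist R x y β r + 3 * ε := by
  have hsub : Set.Icc r s ⊆ Set.Icc 0 T := Set.Icc_subset_Icc hr hs
  have h1 := hx.sub_eq_integral_drift hK ha hKa hT hC (ℓ s) hr hrs hs
  have h2 : ∫ u in r..s, drift K (ℓ u) (x u) (ℓ s) ≤ ∫ _ in r..s, -(δ * c) := by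
    refine intervalIntegral.integral_mono_on hrs ?_ intervalIntegrable_const fun u hu => ?_
    · rw [intervalIntegrable_iff_integrableOn_Icc_of_le hrs]
      exact (hx.integrableOn_drift hK ha hKa hT hC _).mono_set hsub
    · have hul := Icc_subset_lifeInterval hT (hsub hu)
      have h3 := drift_self_le (i := ℓ u) hK.nonneg (hKa (ℓ u)) (δ := δ)
        (fun k hk => hδ _ _ ((hlag u hu).1 ▸ hsn) hk)
        (summable_abs_of_moment (hx.summable_moment hul)) (hx.nonneg hul)
        (fun k hk => hx.eq_zero_of_lt hul hk)
      rw [(hlag u hu).1] at h3 ⊢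
      refine h3.trans (neg_le_neg ?_)
      exact mul_le_mul_of_nonneg_left (hc u (hsub hu)) hδ0
  rw [intervalIntegral.integral_const, smul_eq_mul] at h2
  have hrm : r ∈ Set.Icc r s := ⟨le_rfl, hrs⟩
  have h4 := hx.nonneg (Icc_subset_lifeInterval hT ⟨hr.trans hrs, hs⟩) (ℓ s)
  have h5 := hy.abs_sub_le (x := x) (hsub hrm) (hsn.trans hn)
  rw [hy.eq_zero r (hsub hrm) (ℓ s) ((hlag r hrm).1 ▸ (hlag r hrm).2), sub_zero] at h5
  have h6 := le_abs_self (x r (ℓ s))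
  nlinarith

/-- While the minimal size of the exact solution is the larger one, the component `q s` of the
approximate solution is bounded by the distance of the two. It is depleted as long as the approximate solution
is close enough to the exact one for its `ℓ¹`-norm to be at least `c / 2`. -/
lemma right_behind (hy : IsApproxSolution K T a ε R q y β) (hx : IsSolution K x₀ τ ℓ x)
    (hK : IsCoagulationKernel K) (ha : 0 ≤ a) (hKa : ∀ i j : ℕ+, i ≤ j → K i j ≤ a * (i : ℕ))
    (hT : (T : EReal) < lifespan τ)
    (hC : ∀ t ∈ Set.Icc 0 T, ∑' k : ℕ+, ((k : ℕ) : ℝ) * |x t k| ≤ C) (hC0 : 0 ≤ C)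
    (hc : ∀ t ∈ Set.Icc 0 T, c ≤ ∑' k, x t k) (hδ0 : 0 ≤ δ)
    (hδ : ∀ i j, i ≤ n → i ≤ j → δ ≤ K i j)
    (hn : n ≤ R) (hR : 1 / ((R : ℕ) : ℝ) ≤ ε) (hε : 0 ≤ ε)
    (hsmall : (C + 4) * ε ≤ c / 4) (hsmall' : 3 * a * (n : ℕ) * ε ≤ δ * c / 4)
    {r s : ℝ} (hr : 0 ≤ r) (hrs : r ≤ s) (hs : s ≤ T) (hℓn : ℓ s ≤ n)
    (hlag : ∀ u ∈ Set.Icc r s, q u = q s ∧ q u < ℓ u)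
    (hclose : ∀ u ∈ Set.Icc r s, compDist R x y β u ≤ c / 4) :
    δ * c / 4 * (s - r) ≤ compDist R x y β r + 9 * ε := by
  have hsub : Set.Icc r s ⊆ Set.Icc 0 T := Set.Icc_subset_Icc hr hs
  have hrm : r ∈ Set.Icc r s := ⟨le_rfl, hrs⟩
  have hsm : s ∈ Set.Icc r s := ⟨hrs, le_rfl⟩
  set i := q s with hi
  have hin : i ≤ n := (hlag s hsm).2.le.trans hℓn
  have hiR : i ∈ Finset.Iic R := Finset.mem_Iic.2 (hin.trans hn)
  have h2 : ∫ u in r..s, β u i ≤ ∫ _ in r..s, -(δ * c / 4) := by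
    refine intervalIntegral.integral_mono_on hrs (hy.intervalIntegrable_drift i hr hrs hs)
      intervalIntegrable_const fun u hu => ?_
    have huT := hsub hu
    have hul := Icc_subset_lifeInterval hT huT
    have hqu : q u = i := (hlag u hu).1
    have hys := summable_abs_of_moment (hy.summable u huT)
    have hxs := summable_abs_of_moment (hx.summable_moment hul)
    have h3 := drift_self_le (i := i) hK.nonneg (hKa i) (δ := δ)
      (fun k hk => hδ _ _ hin hk) hys (hy.nonneg u huT)
      (fun k hk => hy.eq_zero u huT k (hqu ▸ hk))
    have h4 : |β u i - drift K (q u) (y u) i| ≤ 3 * a * (q u : ℕ) * ε :=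
      (Finset.single_le_sum (f := fun j => |β u j - drift K (q u) (y u) j|)
        (fun _ _ => abs_nonneg _) hiR).trans (hy.drift_sub_le u huT)
    rw [hqu] at h4
    have h5 := (le_abs_self _).trans h4
    have h6 : 3 * a * ((i : ℕ) : ℝ) * ε ≤ 3 * a * (n : ℕ) * ε := by
      have : ((i : ℕ) : ℝ) ≤ (n : ℕ) := by exact_mod_cast hin
      gcongr
    have h7 := hy.tsum_abs_sub_le hx hT hC hC0 hR huT
    have h8 : ∑' k, x u k - ∑' k, y u k ≤ ∑' k, |(x u - y u) k| := by
      have hd : Summable fun k => |(x u - y u) k| :=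
        summable_abs_of_moment (summable_moment_sub (hx.summable_moment hul) (hy.summable u huT))
      rw [← hxs.of_abs.tsum_sub hys.of_abs]
      exact (hxs.of_abs.sub hys.of_abs).tsum_le_tsum (fun k => le_abs_self _) hd
    -- closeness to the exact solution bounds the `ℓ¹`-norm of `y` from below
    have h9 : c / 2 ≤ ∑' k, y u k := by linarith [hc u huT, hclose u hu]
    have h10 : δ * (c / 2) ≤ δ * ∑' k, y u k := mul_le_mul_of_nonneg_left h9 hδ0
    linarith
  rw [intervalIntegral.integral_const, smul_eq_mul] at h2
  have h3 := intervalIntegral.integral_add_adjacent_intervals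
    (hy.intervalIntegrable_drift i le_rfl hr (hrs.trans hs))
    (hy.intervalIntegrable_drift i hr hrs hs)
  have herr : ∀ t ∈ Set.Icc 0 T, |y t i - y 0 i - ∫ r in (0 : ℝ)..t, β r i| ≤ 3 * ε := fun t ht =>
    (Finset.single_le_sum (f := fun j => |y t j - y 0 j - ∫ r in (0 : ℝ)..t, β r j|)
      (fun _ _ => abs_nonneg _) hiR).trans (hy.error_le t ht)
  have h4 := (abs_le.1 (herr r (hsub hrm))).1
  have h5 := (abs_le.1 (herr s (hsub hsm))).2
  have h6 := hy.nonneg s (hsub hsm) i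
  have h7 := hy.abs_sub_le (x := x) (hsub hrm) (hin.trans hn)
  rw [hx.eq_zero_of_lt (Icc_subset_lifeInterval hT (hsub hrm))
    ((hlag r hrm).1 ▸ (hlag r hrm).2), zero_sub, abs_neg] at h7
  have h8 := le_abs_self (y r i)
  nlinarith

end IsApproxSolution

/-- Stability of the min-driven coagulation equation: approximate solutions with errors of order `ε`
remain at a distance of order `ε` of the solution. -/
theorem IsSolution.stability (hx : IsSolution K x₀ τ ℓ x) (hK : IsCoagulationKernel K)
    (ha : 0 < a) (hKa : ∀ i j : ℕ+, i ≤ j → K i j ≤ a * (i : ℕ)) (hT0 : 0 ≤ T)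
    (hT : (T : EReal) < lifespan τ) :
    ∃ D ε₀ : ℝ, 0 < D ∧ 0 < ε₀ ∧ ∀ ε (R : ℕ+) q y β, 0 < ε → ε ≤ ε₀ → 1 / ((R : ℕ) : ℝ) ≤ ε →
      IsApproxSolution K T a ε R q y β → ∑ j ∈ Finset.Iic R, |x 0 j - y 0 j| ≤ ε →
      ∀ t ∈ Set.Icc 0 T, ∑' k, |(x t - y t) k| ≤ D * ε := by
  obtain ⟨C, hC0, hC⟩ := hx.exists_moment_le hT
  obtain ⟨c, hc0, hc⟩ := hx.exists_le_tsum hT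
  set n := ℓ T with hn
  have hTT : T ∈ Set.Icc 0 T := ⟨hT0, le_rfl⟩
  have hsub := Icc_subset_lifeInterval hT
  have hℓn : ∀ t ∈ Set.Icc 0 T, ℓ t ≤ n := fun t ht =>
    hx.minSize_mono (hsub ht) (hsub hTT) ht.2
  obtain ⟨δ, hδ0, hδ⟩ := exists_kernel_lower_bound hK n
  have hn0 : (0 : ℝ) < (n : ℕ) := by exact_mod_cast n.pos
  obtain ⟨D, ε₁, hD, hε₁, hmain⟩ := StageComparison.exists_bound_of_stage_le (T := T)
    (B := 4 * a * C + 7 * a) (L := 4 * a * (n : ℕ) * (C + 5)) (E := 9) (c₁ := δ * c / 4)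
    (c₂ := c / 4) hT0 (by positivity) (by positivity) (by norm_num) (by positivity)
    (by positivity) n
  refine ⟨D + (C + 4), min ε₁ (min (c / 4 / (C + 4)) (min (δ * c / 4 / (3 * a * (n : ℕ)))
    (1 / (n : ℕ)))), by linarith, by positivity, fun ε R q y β hε hεle hR hy hinit t ht => ?_⟩
  have hε1 : ε ≤ ε₁ := hεle.trans (min_le_left _ _)
  have hεle2 := hεle.trans (min_le_right _ _)
  have hε2 : (C + 4) * ε ≤ c / 4 := by
    have := hεle2.trans (min_le_left _ _)
    rw [le_div_iff₀ (by positivity)] at this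
    linarith
  have hεle3 := hεle2.trans (min_le_right _ _)
  have hε3 : 3 * a * (n : ℕ) * ε ≤ δ * c / 4 := by
    have := hεle3.trans (min_le_left _ _)
    rw [le_div_iff₀ (by positivity)] at this
    linarith
  have hnR : n ≤ R := by
    have h1 := hR.trans (hεle3.trans (min_le_right _ _))
    have hR0 : (0 : ℝ) < (R : ℕ) := by exact_mod_cast R.pos
    rw [one_div_le_one_div hR0 hn0] at h1
    exact_mod_cast h1
  have H : StageComparison T (4 * a * C + 7 * a) (4 * a * (n : ℕ) * (C + 5)) 9 (δ * c / 4) (c / 4)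
      ε (compDist R x y β)
      (fun r => ∑ j ∈ Finset.Iic R, |drift K (ℓ r) (x r) j - β r j|) ℓ q :=
    { initial := by simpa [compDist] using hinit
      continuousOn := hy.continuousOn_compDist hx hT0 hT
      growth := fun s t b hs hst ht hb => hy.compDist_le_add hx hK ha.le hKa hT hC hs hst ht hb
      rate_le := fun r hr => hy.rate_le hx hK ha.le hKa hT hC hr
      rate_le_of_eq := fun r hr hq =>
        hy.rate_le_of_eq hx hK ha.le hKa hT hC hC0 hR hε.le hr hq (hℓn r hr)
      mono_left := hx.minSize_mono.mono hsub
      mono_right := hy.mono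
      left_behind := fun r s hr hrs hs hlag _ => by
        have h := hy.left_behind hx hK ha.le hKa hT hC hc hδ0.le hδ hnR hr hrs hs
          (hℓn s ⟨hr.trans hrs, hs⟩) hlag
        have h2 : 0 ≤ δ * c * (s - r) := mul_nonneg (by positivity) (by linarith)
        linarith
      right_behind := fun r s hr hrs hs hlag hclose =>
        hy.right_behind hx hK ha.le hKa hT hC hC0 hc hδ0.le hδ hnR hR hε.le hε2 hε3 hr hrs hs
          (hℓn s ⟨hr.trans hrs, hs⟩) hlag hclose }
  have h1 := hmain ε _ _ _ _ hε hε1 H t ht <| by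
    rw [PNat.coe_le_coe]
    exact (min_le_left _ _).trans (hℓn t ht)
  have h2 := hy.tsum_abs_sub_le hx hT hC hC0 hR ht
  linarith

end Stability

/-! ### Step functions as approximate solutions -/

section StepPath

variable {h T : ℝ}

lemma integrableOn_step (g : ℕ → ℝ) (hh : 0 < h) (T : ℝ) :
    IntegrableOn (fun r => g ⌊r / h⌋₊) (Set.Icc 0 T) := by
  have hm : Measurable fun r : ℝ => g ⌊r / h⌋₊ :=
    (measurable_from_nat (f := g)).comp (Nat.measurable_floor.comp (measurable_id.div_const h))
  refine Integrable.of_bound (C := ∑ k ∈ Finset.range (⌊T / h⌋₊ + 1), |g k|)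
    hm.aestronglyMeasurable ((ae_restrict_iff' measurableSet_Icc).2
    (Eventually.of_forall fun r hr => ?_))
  refine Finset.single_le_sum (f := fun k => |g k|) (fun _ _ => abs_nonneg _)
    (Finset.mem_range.2 (Nat.lt_succ_of_le (Nat.floor_le_floor ?_)))
  exact div_le_div_of_nonneg_right hr.2 hh.le

lemma integral_step_piece (g : ℕ → ℝ) (hh : 0 < h) {l : ℕ} {s : ℝ} (h1 : l * h ≤ s)
    (h2 : s ≤ (l + 1) * h) : ∫ r in (l * h)..s, g ⌊r / h⌋₊ = (s - l * h) * g l := by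
  have hc : ∫ r in (l * h)..s, g ⌊r / h⌋₊ = ∫ _ in (l * h)..s, g l := by
    refine intervalIntegral.integral_congr_uIoo fun r hr => ?_
    rw [Set.uIoo_of_le h1] at hr
    have hl : ⌊r / h⌋₊ = l := by
      have h0 : (0 : ℝ) ≤ l * h := by positivity
      rw [Nat.floor_eq_iff (div_nonneg (h0.trans hr.1.le) hh.le), le_div_iff₀ hh, div_lt_iff₀ hh]
      exact ⟨hr.1.le, hr.2.trans_le h2⟩
    simp only [hl]
  rw [hc, intervalIntegral.integral_const, smul_eq_mul]

lemma integral_step (g : ℕ → ℝ) (hh : 0 < h) {t : ℝ} (ht : 0 ≤ t) :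
    ∫ r in (0 : ℝ)..t, g ⌊r / h⌋₊ =
      h * ∑ l ∈ Finset.range ⌊t / h⌋₊, g l + (t - ⌊t / h⌋₊ * h) * g ⌊t / h⌋₊ := by
  set k := ⌊t / h⌋₊ with hk
  have hk1 : k * h ≤ t := by
    rw [← le_div_iff₀ hh]
    exact Nat.floor_le (div_nonneg ht hh.le)
  have hk2 : t ≤ (k + 1) * h := by
    rw [← div_le_iff₀ hh]
    exact (Nat.lt_floor_add_one _).le
  have hint : ∀ a b : ℝ, 0 ≤ a → a ≤ b →
      IntervalIntegrable (fun r => g ⌊r / h⌋₊) volume a b := fun a b ha hab => by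
    rw [intervalIntegrable_iff_integrableOn_Icc_of_le hab]
    exact (integrableOn_step g hh b).mono_set (Set.Icc_subset_Icc ha le_rfl)
  have hsum := intervalIntegral.sum_integral_adjacent_intervals (μ := volume)
    (f := fun r => g ⌊r / h⌋₊) (a := fun l : ℕ => (l : ℝ) * h) (n := k) fun l _ => by
      refine hint _ _ (by positivity) ?_
      push_cast
      nlinarith
  simp only [Nat.cast_zero, zero_mul] at hsum
  rw [← intervalIntegral.integral_add_adjacent_intervals (hint 0 (k * h) le_rfl (by positivity))
    (hint _ _ (by positivity) hk1), ← hsum, integral_step_piece g hh hk1 hk2, Finset.mul_sum]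
  congr 1
  refine Finset.sum_congr rfl fun l _ => ?_
  have h3 := integral_step_piece g hh (l := l) (s := ((l + 1 : ℕ) : ℝ) * h)
    (by push_cast; nlinarith) (by push_cast; exact le_rfl)
  rw [h3]
  push_cast
  ring

variable {K : ℕ+ → ℕ+ → ℝ} {a ε : ℝ} {R : ℕ+} {N : ℕ}

lemma minSize_le_mass {X : Config} (hX : X ≠ 0) : (minSize X : ℕ) ≤ mass X := by
  have h1 := minSize_mem hX
  have h2 : (minSize X : ℕ) * X (minSize X) ≤ mass X :=
    Finset.single_le_sum (f := fun i : ℕ+ => (i : ℕ) * X i) (fun _ _ => Nat.zero_le _)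
      (Finsupp.mem_support_iff.2 h1)
  exact (Nat.le_mul_of_pos_right _ (Nat.pos_of_ne_zero h1)).trans h2

/-- The exclusion of self-interactions changes the drift by `O(1 / N)`. -/
lemma sum_abs_genDrift_sub_le (hK : IsCoagulationKernel K)
    (hKa : ∀ i j : ℕ+, i ≤ j → K i j ≤ a * (i : ℕ)) {X : Config} (hX : X ≠ 0) (J : Finset ℕ+) :
    ∑ j ∈ J, |genDrift K N X j - drift K (minSize X) (renorm N X) j| ≤
      3 * a * (minSize X : ℕ) * (1 / N) := by
  set l := minSize X with hl
  have hk0 : 0 ≤ K l l / N := div_nonneg (hK.nonneg _ _) (Nat.cast_nonneg _)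
  have h1 : ∀ j, |genDrift K N X j - drift K l (renorm N X) j| ≤
      K l l / N * ((if j = l then 2 else 0) + if j = l + l then 1 else 0) := by
    intro j
    rw [genDrift_eq hK.symm hX, ← hl, add_sub_cancel_left, abs_mul, abs_of_nonneg hk0]
    refine mul_le_mul_of_nonneg_left ((abs_sub _ _).trans (le_of_eq ?_)) hk0
    congr 1 <;> split_ifs <;> simp
  refine (Finset.sum_le_sum fun j _ => h1 j).trans ?_
  rw [← Finset.mul_sum, Finset.sum_add_distrib, Finset.sum_ite_eq', Finset.sum_ite_eq']
  have h2 : ((if l ∈ J then (2 : ℝ) else 0) + if l + l ∈ J then 1 else 0) ≤ 3 := by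
    split_ifs <;> norm_num
  refine (mul_le_mul_of_nonneg_left h2 hk0).trans ?_
  have h3 : K l l / N ≤ a * (l : ℕ) / N := div_le_div_of_nonneg_right (hKa l l le_rfl)
    (Nat.cast_nonneg _)
  calc K l l / N * 3 ≤ a * (l : ℕ) / N * 3 := by linarith
    _ = _ := by ring

lemma sum_abs_genDrift_le (hK : IsCoagulationKernel K) (ha : 0 ≤ a)
    (hKa : ∀ i j : ℕ+, i ≤ j → K i j ≤ a * (i : ℕ)) (hN : N ≠ 0) {X : Config} (hX : mass X = N)
    (J : Finset ℕ+) : ∑ j ∈ J, |genDrift K N X j| ≤ 7 * a := by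
  have hX0 := ne_zero_of_mass hN hX
  have hN0 : (0 : ℝ) < N := by exact_mod_cast Nat.pos_of_ne_zero hN
  have h1 := sum_abs_genDrift_sub_le (N := N) hK hKa hX0 J
  have h2 := sum_abs_drift_le_moment hK.nonneg hK.symm ha hKa (summable_moment_renorm N X)
    (i := minSize X) (fun k hk => by simp [renorm, eq_zero_of_lt_minSize hk]) J
  rw [tsum_moment_renorm, hX, div_self hN0.ne'] at h2
  have h3 : 3 * a * ((minSize X : ℕ) : ℝ) * (1 / N) ≤ 3 * a := by
    -- the correction is not small for a minimal size of order `N`, but it stays bounded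
    have h4 : ((minSize X : ℕ) : ℝ) * (1 / N) ≤ 1 := by
      rw [mul_one_div, div_le_one hN0]
      exact_mod_cast (minSize_le_mass hX0).trans hX.le
    rw [mul_assoc]
    exact mul_le_of_le_one_right (by positivity) h4
  have h5 : ∑ j ∈ J, |genDrift K N X j| ≤
      ∑ j ∈ J, |genDrift K N X j - drift K (minSize X) (renorm N X) j| +
        ∑ j ∈ J, |drift K (minSize X) (renorm N X) j| := by
    rw [← Finset.sum_add_distrib]
    refine Finset.sum_le_sum fun j _ => ?_
    have := abs_add_le (genDrift K N X j - drift K (minSize X) (renorm N X) j)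
      (drift K (minSize X) (renorm N X) j)
    rwa [sub_add_cancel] at this
  linarith

/-- A sequence of configurations which follows the drift of the stochastic process at the times
`k * h` defines, as a step function, an approximate solution of the deterministic equation. -/
lemma isApproxSolution_step (hK : IsCoagulationKernel K) (ha : 0 ≤ a)
    (hKa : ∀ i j : ℕ+, i ≤ j → K i j ≤ a * (i : ℕ)) (hN : N ≠ 0) (hNε : 1 / (N : ℝ) ≤ ε)
    {M : ℕ} (hh : 0 < h) (hT : M * h = T) (hhε : h * (7 * a) ≤ ε) {Y : ℕ → Config}
    (hmass : ∀ k ≤ M, mass (Y k) = N) (hmono : ∀ k < M, minSize (Y k) ≤ minSize (Y (k + 1)))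
    (herr : ∀ k ≤ M, ∑ j ∈ Finset.Iic R, |renorm N (Y k) j - renorm N (Y 0) j -
      h * ∑ l ∈ Finset.range k, genDrift K N (Y l) j| ≤ 2 * ε) :
    IsApproxSolution K T a ε R (fun t => minSize (Y ⌊t / h⌋₊)) (fun t => renorm N (Y ⌊t / h⌋₊))
      (fun t => genDrift K N (Y ⌊t / h⌋₊)) := by
  have hN0 : (0 : ℝ) < N := by exact_mod_cast Nat.pos_of_ne_zero hN
  have hfl : ∀ t ∈ Set.Icc 0 T, ⌊t / h⌋₊ ≤ M := fun t ht => by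
    refine Nat.floor_le_of_le ?_
    rw [div_le_iff₀ hh, hT]
    exact ht.2
  have hne : ∀ k ≤ M, Y k ≠ 0 := fun k hk => ne_zero_of_mass hN (hmass k hk)
  refine ⟨fun t _ j => by simp only [renorm]; positivity,
    fun t _ j hj => by simp [renorm, eq_zero_of_lt_minSize hj],
    fun t _ => summable_moment_renorm _ _, fun t ht => ?_, ?_,
    fun j => integrableOn_step (fun k => genDrift K N (Y k) j) hh T,
    fun t ht => sum_abs_genDrift_le hK ha hKa hN (hmass _ (hfl t ht)) _, fun t ht => ?_,
    fun t ht => ?_⟩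
  · rw [tsum_moment_renorm, hmass _ (hfl t ht), div_self hN0.ne']
  · intro s _ t ht hst
    have h1 : ∀ n m : ℕ, n + m ≤ M → minSize (Y n) ≤ minSize (Y (n + m)) := by
      intro n m
      induction m with
      | zero => exact fun _ => le_rfl
      | succ m ih => exact fun hm => (ih (by omega)).trans (hmono (n + m) (by omega))
    obtain ⟨m, hm⟩ := Nat.exists_eq_add_of_le
      (Nat.floor_le_floor (div_le_div_of_nonneg_right hst hh.le))
    have h2 := hfl t ht
    simp only
    rw [hm] at h2 ⊢
    exact h1 _ _ h2
  · refine (sum_abs_genDrift_sub_le hK hKa (hne _ (hfl t ht)) _).trans ?_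
    gcongr
  · set k := ⌊t / h⌋₊ with hk
    have hk1 : k * h ≤ t := by
      rw [← le_div_iff₀ hh]
      exact Nat.floor_le (div_nonneg ht.1 hh.le)
    have hk2 : t - k * h ≤ h := by
      have : t ≤ (k + 1) * h := by
        rw [← div_le_iff₀ hh]
        exact (Nat.lt_floor_add_one _).le
      linarith
    have h0 : ⌊(0 : ℝ) / h⌋₊ = 0 := by simp
    have h1 : ∀ j, |renorm N (Y k) j - renorm N (Y ⌊(0 : ℝ) / h⌋₊) j -
        ∫ r in (0 : ℝ)..t, genDrift K N (Y ⌊r / h⌋₊) j| ≤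
        |renorm N (Y k) j - renorm N (Y 0) j - h * ∑ l ∈ Finset.range k, genDrift K N (Y l) j| +
          h * |genDrift K N (Y k) j| := by
      intro j
      rw [h0, integral_step (fun k => genDrift K N (Y k) j) hh ht.1, ← sub_sub]
      refine (abs_sub _ _).trans (add_le_add le_rfl ?_)
      rw [abs_mul, abs_of_nonneg (by linarith)]
      exact mul_le_mul_of_nonneg_right hk2 (abs_nonneg _)
    refine (Finset.sum_le_sum fun j _ => h1 j).trans ?_
    rw [Finset.sum_add_distrib, ← Finset.mul_sum]
    have h2 := mul_le_mul_of_nonneg_left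
      (sum_abs_genDrift_le hK ha hKa hN (hmass k (hfl t ht)) (Finset.Iic R)) hh.le
    linarith [herr k (hfl t ht)]

end StepPath

/-! ### The process sampled on a grid -/

section Sampling

set_option linter.unusedSectionVars false

variable {Ω : Type*} [mΩ : MeasurableSpace Ω] {P : Measure Ω} [IsProbabilityMeasure P]
  {K : ℕ+ → ℕ+ → ℝ} {X₀ : Ω → Config} {X : ℝ≥0 → Ω → Config} {N : ℕ}

lemma past_le (hX : ∀ t, Measurable (X t)) (s : ℝ≥0) : past X s ≤ mΩ :=
  iSup₂_le fun r _ => (hX r).comap_le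

lemma past_mono (X : ℝ≥0 → Ω → Config) {s t : ℝ≥0} (hst : s ≤ t) : past X s ≤ past X t :=
  iSup₂_le fun r hr => le_iSup₂_of_le (f := fun r (_ : r ∈ Set.Iic t) =>
    MeasurableSpace.comap (X r) inferInstance) r (le_trans hr hst) le_rfl

lemma measurable_past (X : ℝ≥0 → Ω → Config) (s : ℝ≥0) : Measurable[past X s] (X s) :=
  (comap_measurable (X s)).mono (le_iSup₂_of_le (f := fun r (_ : r ∈ Set.Iic s) =>
    MeasurableSpace.comap (X r) inferInstance) s (Set.mem_Iic.2 le_rfl) le_rfl) le_rfl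

/-- The filtration generated by the process, sampled at the times `k * h`. -/
def gridFiltration (hX : ∀ t, Measurable (X t)) (h : ℝ≥0) : Filtration ℕ mΩ where
  seq k := past X (k * h)
  mono' k l hkl := past_mono X (mul_le_mul_left (by exact_mod_cast hkl) h)
  le' k := past_le hX _

/-- Decomposition of an event according to the value of a random configuration of mass `N`. -/
lemma sum_measureReal_shell {W : Ω → Config} (hW : Measurable W) {A : Set Ω}
    (hA : MeasurableSet A) :
    ∑ Z : Shell N, P.real (A ∩ {ω | W ω = Z}) = P.real (A ∩ {ω | mass (W ω) = N}) := by
  rw [← measureReal_biUnion_finset]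
  · congr 1
    ext ω
    simp
  · intro Y _ Z _ hYZ
    refine Set.disjoint_left.2 fun ω h1 h2 => hYZ (Subtype.ext ?_)
    exact h1.2.symm.trans h2.2
  · exact fun Z _ => hA.inter (hW (MeasurableSet.singleton Z.1))

lemma sum_generator_row (N : ℕ) (Y : Shell N) : ∑ Z, generator K N Y Z = 0 := by
  have h := sum_generator_mul (K := K) N Y fun _ => 1
  simpa using h

namespace IsMinDrivenProcess

/-- The mass is conserved. -/
lemma ae_mass_eq (hX : IsMinDrivenProcess P K X₀ X) (h0 : ∀ᵐ ω ∂P, mass (X₀ ω) = N) (s : ℝ≥0) :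
    ∀ᵐ ω ∂P, mass (X s ω) = N := by
  have hA0 : MeasurableSet {ω | mass (X 0 ω) = N} :=
    hX.measurable 0 (MeasurableSpace.measurableSet_top (s := {Y | mass Y = N}))
  have hAs : MeasurableSet {ω | mass (X s ω) = N} :=
    hX.measurable s (MeasurableSpace.measurableSet_top (s := {Y | mass Y = N}))
  have h0' : ∀ᵐ ω ∂P, mass (X 0 ω) = N := by
    filter_upwards [h0, hX.initial] with ω h1 h2
    rw [h2, h1]
  have hone : P.real {ω | mass (X 0 ω) = N} = 1 := by
    rw [measureReal_def, (mem_ae_iff_prob_eq_one hA0).1 h0', ENNReal.toReal_one]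
  have h1 : ∀ Y : Shell N, P.real ({ω | X 0 ω = Y} ∩ {ω | mass (X s ω) = N}) =
      P.real {ω | X 0 ω = Y} := by
    intro Y
    have hY : MeasurableSet {ω | X 0 ω = Y.1} := hX.measurable 0 (MeasurableSet.singleton Y.1)
    rw [← sum_measureReal_shell (hX.measurable s) hY]
    have h2 := fun Z => hX.markov 0 s Set.univ MeasurableSet.univ N Y Z
    simp only [Set.univ_inter, zero_add] at h2
    refine (Finset.sum_congr rfl fun Z _ => h2 Z).trans ?_
    rw [← Finset.mul_sum, sum_exp_smul_row (sum_generator_row N), mul_one]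
  have h2 : P.real ({ω | mass (X s ω) = N} ∩ {ω | mass (X 0 ω) = N}) = 1 := by
    rw [← hone, ← sum_measureReal_shell (hX.measurable 0) hAs]
    have h3 := sum_measureReal_shell (P := P) (N := N) (hX.measurable 0) MeasurableSet.univ
    simp only [Set.univ_inter] at h3
    rw [← h3]
    exact Finset.sum_congr rfl fun Y _ => by rw [Set.inter_comm, h1]
  have h3 : P.real {ω | mass (X s ω) = N} = 1 :=
    le_antisymm measureReal_le_one (h2 ▸ measureReal_mono Set.inter_subset_left)
  refine (mem_ae_iff_prob_eq_one hAs).2 ?_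
  rw [← ENNReal.toReal_eq_one_iff]
  exact h3

/-- The minimal size does not decrease between two given times. -/
lemma ae_minSize_le (hX : IsMinDrivenProcess P K X₀ X) (h0 : ∀ᵐ ω ∂P, mass (X₀ ω) = N)
    (s h : ℝ≥0) : ∀ᵐ ω ∂P, minSize (X s ω) ≤ minSize (X (s + h) ω) := by
  have hpair : ∀ Y Z : Shell N, minSize Z.1 < minSize Y.1 →
      ∀ᵐ ω ∂P, ¬ (X s ω = Y ∧ X (s + h) ω = Z) := by
    intro Y Z hYZ
    have h1 := hX.markov s h Set.univ MeasurableSet.univ N Y Z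
    have h2 : NormedSpace.exp ((h : ℝ) • generator K N) Y Z = 0 :=
      Matrix.BlockTriangular.exp (M := (h : ℝ) • generator K N)
        (b := fun Y : Shell N => minSize Y.1) (fun U V hUV => by
          rw [Matrix.smul_apply, generator_blockTriangular N hUV, smul_zero]) hYZ
    rw [h2, mul_zero, measureReal_eq_zero_iff] at h1
    rw [ae_iff]
    convert h1 using 2
    ext ω
    simp
  have hall : ∀ᵐ ω ∂P, ∀ Y Z : Shell N, minSize Z.1 < minSize Y.1 →
      ¬ (X s ω = Y ∧ X (s + h) ω = Z) := by
    rw [ae_all_iff]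
    intro Y
    rw [ae_all_iff]
    intro Z
    by_cases hYZ : minSize Z.1 < minSize Y.1
    · filter_upwards [hpair Y Z hYZ] with ω hω _ using hω
    · exact Eventually.of_forall fun ω hcon => absurd hcon hYZ
  filter_upwards [hall, hX.ae_mass_eq h0 s, hX.ae_mass_eq h0 (s + h)] with ω h1 h2 h3
  by_contra! hcon
  exact h1 ⟨X s ω, h2⟩ ⟨X (s + h) ω, h3⟩ hcon ⟨rfl, rfl⟩

end IsMinDrivenProcess

/-- A configuration of mass `N`. -/
noncomputable def defaultShell (N : ℕ) : Shell N :=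
  ⟨Finsupp.single 1 N, by simp [mass_single]⟩

open Classical in
/-- The projection of configurations onto those of mass `N`; configurations of a different mass,
which almost surely do not occur, are sent to `defaultShell N`. -/
noncomputable def toShell (N : ℕ) (Y : Config) : Shell N :=
  if h : mass Y = N then ⟨Y, h⟩ else defaultShell N

lemma toShell_coe {Y : Config} (hY : mass Y = N) : (toShell N Y).1 = Y := by
  simp [toShell, hY]

namespace IsMinDrivenProcess

/-- Sampled at the times `k * h`, the process is a Markov chain on the configurations of mass
`N`. -/
lemma isMarkovChain (hX : IsMinDrivenProcess P K X₀ X)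
    (h0 : ∀ᵐ ω ∂P, mass (X₀ ω) = N) (h : ℝ≥0) :
    IsMarkovChain P (gridFiltration hX.measurable h)
      (NormedSpace.exp ((h : ℝ) • generator K N)) fun k ω => toShell N (X (k * h) ω) where
  adapted k := (measurable_from_top (f := toShell N)).comp (measurable_past X (k * h))
  step k A hA Y Z := by
    have h1 := hX.markov (k * h) h A hA N Y Z
    have hiff : ∀ (s : ℝ≥0) (U : Shell N), ∀ᵐ ω ∂P, toShell N (X s ω) = U ↔ X s ω = U := by
      intro s U
      filter_upwards [hX.ae_mass_eq h0 s] with ω hω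
      rw [← Subtype.coe_inj, toShell_coe hω]
    have hk : ((k + 1 : ℕ) : ℝ≥0) * h = k * h + h := by push_cast; ring
    have h2 : P.real (A ∩ {ω | toShell N (X (k * h) ω) = Y}) =
        P.real (A ∩ {ω | X (k * h) ω = Y}) := by
      refine measureReal_congr ?_
      filter_upwards [hiff (k * h) Y] with ω hω
      exact propext (and_congr_right fun _ => hω)
    have h3 : P.real (A ∩ {ω | toShell N (X (k * h) ω) = Y} ∩
        {ω | toShell N (X ((k + 1 : ℕ) * h) ω) = Z}) =
        P.real (A ∩ {ω | X (k * h) ω = Y} ∩ {ω | X (k * h + h) ω = Z}) := by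
      refine measureReal_congr ?_
      rw [hk]
      filter_upwards [hiff (k * h) Y, hiff (k * h + h) Z] with ω hω hω'
      exact propext (and_congr (and_congr_right fun _ => hω) hω')
    rw [h2, h3, h1]

end IsMinDrivenProcess

/-- The generator applied to the quadratic variation of the renormalized components: there are at
most `a * N` jumps per unit of time, each of them of size `O(1 / N)`. -/
lemma sum_generator_sq_le (hK : IsCoagulationKernel K) {a : ℝ} (ha : 0 ≤ a)
    (hKa : ∀ i j : ℕ+, i ≤ j → K i j ≤ a * (i : ℕ)) (hN : N ≠ 0) (J : Finset ℕ+) (Y : Shell N) :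
    ∑ Z, generator K N Y Z * ∑ j ∈ J, (renorm N Z.1 j - renorm N Y.1 j) ^ 2 ≤ 9 * a / N := by
  have hN0 : (0 : ℝ) < N := by exact_mod_cast Nat.pos_of_ne_zero hN
  have h1 := sum_generator_mul (K := K) N Y fun Z => ∑ j ∈ J, (renorm N Z j - renorm N Y.1 j) ^ 2
  rw [h1]
  have h2 : ∀ k ∈ Y.1.support, mergeRate K Y.1 k *
      (∑ j ∈ J, (renorm N (merge Y.1 k) j - renorm N Y.1 j) ^ 2 -
        ∑ j ∈ J, (renorm N Y.1 j - renorm N Y.1 j) ^ 2) ≤ mergeRate K Y.1 k * (9 / N ^ 2) := by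
    intro k hk
    by_cases hr : mergeRate K Y.1 k = 0
    · simp [hr]
    refine mul_le_mul_of_nonneg_left ?_ (mergeRate_nonneg hK.nonneg hk)
    simp only [sub_self, ne_eq, OfNat.ofNat_ne_zero, not_false_eq_true, zero_pow,
      Finset.sum_const_zero, sub_zero]
    have h3 : ∀ j, (renorm N (merge Y.1 k) j - renorm N Y.1 j) ^ 2 ≤
        3 / N ^ 2 * ((if j = minSize Y.1 then 1 else 0) + (if j = k then 1 else 0) +
          if j = minSize Y.1 + k then 1 else 0) := by
      intro j
      have h4 : renorm N (merge Y.1 k) j - renorm N Y.1 j =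
          (-(if j = minSize Y.1 then 1 else 0) - (if j = k then 1 else 0) +
            if j = minSize Y.1 + k then 1 else 0) / N := by
        rw [renorm, renorm, merge_apply hk hr j]
        ring
      rw [h4, div_pow, div_mul_eq_mul_div]
      refine div_le_div_of_nonneg_right ?_ (by positivity)
      split_ifs <;> norm_num
    refine (Finset.sum_le_sum fun j _ => h3 j).trans ?_
    rw [← Finset.mul_sum, Finset.sum_add_distrib, Finset.sum_add_distrib, Finset.sum_ite_eq',
      Finset.sum_ite_eq', Finset.sum_ite_eq']
    have h5 : ((if minSize Y.1 ∈ J then (1 : ℝ) else 0) + (if k ∈ J then 1 else 0) +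
        if minSize Y.1 + k ∈ J then 1 else 0) ≤ 3 := by
      split_ifs <;> norm_num
    refine (mul_le_mul_of_nonneg_left h5 (by positivity)).trans (le_of_eq ?_)
    ring
  refine (Finset.sum_le_sum h2).trans ?_
  rw [← Finset.sum_mul]
  have h3 := sum_mergeRate_le (X := Y.1) hK.nonneg ha hKa
  rw [Y.2] at h3
  refine (mul_le_mul_of_nonneg_right h3 (by positivity)).trans (le_of_eq ?_)
  field_simp

/-- For a small time step `h`, the compensators of the components of the sampled process are close
to `h * genDrift`, and the increments have second moments of order `h / N`. -/
lemma eventually_meanIncr_and_sq_le (hK : IsCoagulationKernel K) {a : ℝ} (ha : 0 < a)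
    (hKa : ∀ i j : ℕ+, i ≤ j → K i j ≤ a * (i : ℕ)) (hN : N ≠ 0) (J : Finset ℕ+) {η : ℝ}
    (hη : 0 < η) :
    ∀ᶠ h in 𝓝[>] (0 : ℝ),
      (∀ j ∈ J, ∀ Y : Shell N, |meanIncr (NormedSpace.exp (h • generator K N))
        (fun Z : Shell N => renorm N Z.1 j) Y - h * genDrift K N Y.1 j| ≤ h * η) ∧
      ∀ Y : Shell N, ∑ j ∈ J, ∑ Z, NormedSpace.exp (h • generator K N) Y Z *
        (renorm N Z.1 j - renorm N Y.1 j) ^ 2 ≤ h * (10 * a / N) := by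
  have hN0 : (0 : ℝ) < N := by exact_mod_cast Nat.pos_of_ne_zero hN
  have h1 : ∀ᶠ h in 𝓝[>] (0 : ℝ), ∀ j ∈ J, ∀ Y : Shell N,
      |∑ Z, NormedSpace.exp (h • generator K N) Y Z * (renorm N Z.1 j - renorm N Y.1 j) -
        h * ∑ Z, generator K N Y Z * (renorm N Z.1 j - renorm N Y.1 j)| ≤ h * η := by
    rw [eventually_all_finset]
    exact fun j _ => eventually_abs_exp_smul_sub_le (generator K N)
      (fun Y Z => renorm N Z.1 j - renorm N Y.1 j) (fun Y => sub_self _) hη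
  have h2 := eventually_abs_exp_smul_sub_le (generator K N)
      (fun Y Z => ∑ j ∈ J, (renorm N Z.1 j - renorm N Y.1 j) ^ 2) (fun Y => by simp)
      (div_pos ha hN0)
  filter_upwards [h1, h2, self_mem_nhdsWithin] with h h1 h2 hpos
  refine ⟨fun j hj Y => ?_, fun Y => ?_⟩
  · have h3 := h1 j hj Y
    rw [sum_generator_mul N Y fun Z => renorm N Z j - renorm N Y.1 j] at h3
    simpa only [meanIncr, genDrift, sub_self, sub_zero] using h3
  · have h3 := (abs_le.1 (h2 Y)).2
    have h4 := mul_le_mul_of_nonneg_left (sum_generator_sq_le hK ha.le hKa hN J Y)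
      (le_of_lt (Set.mem_Ioi.1 hpos))
    rw [Finset.sum_comm]
    simp only [← Finset.mul_sum]
    have h5 : h * (10 * a / N) = h * (9 * a / N) + h * (a / N) := by ring
    linarith

end Sampling

/-! ### Deviations on dyadic grids -/

section GridEvent

set_option linter.unusedSectionVars false

variable {Ω : Type*} [mΩ : MeasurableSpace Ω] {P : Measure Ω} [IsProbabilityMeasure P]
  {K : ℕ+ → ℕ+ → ℝ} {X₀ : Ω → Config} {X : ℝ≥0 → Ω → Config} {N : ℕ}
  {x₀ : ℕ+ → ℝ} {τ : ℕ → ℝ} {ℓ : ℝ → ℕ+} {x : ℝ → ℕ+ → ℝ} {T a ε D : ℝ} {R : ℕ+}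

/-- The event that the renormalized process is at a distance larger than `b` of `x` at one of the
times `k * h`, `k ≤ M`. -/
def farOnGrid (N : ℕ) (X : ℝ≥0 → Ω → Config) (x : ℝ → ℕ+ → ℝ) (b : ℝ) (h : ℝ≥0) (M : ℕ) : Set Ω :=
  {ω | ∃ k ≤ M, b < ∑' j, |(x ((k * h : ℝ≥0) : ℝ) - renorm N (X (k * h) ω)) j|}

/-- Deviations from the solution on a fine grid are caused by a deviation of the initial condition
or by a fluctuation of the martingale part. -/
lemma eventually_measureReal_farOnGrid_le (hX : IsMinDrivenProcess P K X₀ X)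
    (hmass : ∀ᵐ ω ∂P, mass (X₀ ω) = N) (hK : IsCoagulationKernel K) (ha : 0 < a)
    (hKa : ∀ i j : ℕ+, i ≤ j → K i j ≤ a * (i : ℕ)) (hN : N ≠ 0) (hNε : 1 / (N : ℝ) ≤ ε)
    (hT : 0 < T) (hε : 0 < ε) (hx0 : x 0 = x₀)
    (hx₀ : Summable fun k : ℕ+ => ((k : ℕ) : ℝ) * |x₀ k|)
    (hstab : ∀ q y β, IsApproxSolution K T a ε R q y β →
      ∑ j ∈ Finset.Iic R, |x 0 j - y 0 j| ≤ ε → ∀ t ∈ Set.Icc 0 T,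
        ∑' k, |(x t - y t) k| ≤ D * ε) :
    ∀ᶠ r in 𝓝[>] (0 : ℝ), ∀ (h : ℝ≥0) (M : ℕ), (h : ℝ) = r → M * r = T →
      P.real (farOnGrid N X x (D * ε) h M) ≤
        P.real {ω | ENNReal.ofReal ε < l1Norm (renorm N (X₀ ω) - x₀)} +
          T * (10 * a / N) / (ε ^ 2 / (R : ℕ)) := by
  have hR0 : (0 : ℝ) < (R : ℕ) := by exact_mod_cast R.pos
  have hcard : ((Finset.Iic R).card : ℝ) = (R : ℕ) := by
    have : Finset.Iic R = Finset.Icc 1 R := by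
      ext
      simp
    rw [this, PNat.card_Icc]
    simp
  have hsmall : ∀ᶠ r in 𝓝[>] (0 : ℝ), r * (7 * a) ≤ ε := by
    have : Tendsto (fun r : ℝ => r * (7 * a)) (𝓝[>] 0) (𝓝 (0 * (7 * a))) :=
      (tendsto_id.mul_const _).mono_left nhdsWithin_le_nhds
    rw [zero_mul] at this
    exact this.eventually_le_const hε
  filter_upwards [eventually_meanIncr_and_sq_le hK ha hKa hN (Finset.Iic R)
    (η := ε / (T * (R : ℕ))) (by positivity), hsmall, self_mem_nhdsWithin] with
    r hgen hrε hr h M hhr hM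
  have hr0 : 0 < r := hr
  have hchain := hX.isMarkovChain hmass h
  rw [hhr] at hchain
  set Q := NormedSpace.exp (r • generator K N) with hQ
  set lam := ε ^ 2 / (R : ℕ) with hlam
  have hlam0 : 0 < lam := by positivity
  have hmart := hchain.maximal_ineq (Finset.Iic R) (fun j (Z : Shell N) => renorm N Z.1 j)
    hgen.2 hlam0 M
  set mart := {ω | ∃ k ≤ M, lam ≤ ∑ j ∈ Finset.Iic R,
    martPart Q (fun Z : Shell N => renorm N Z.1 j) (fun k ω => toShell N (X (k * h) ω)) k ω ^ 2}
  set init := {ω | ENNReal.ofReal ε < l1Norm (renorm N (X₀ ω) - x₀)}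
  have hsub : farOnGrid N X x (D * ε) h M ≤ᵐ[P] (init ∪ mart : Set Ω) := by
    have hm : ∀ᵐ ω ∂P, ∀ k : ℕ, mass (X (k * h) ω) = N :=
      ae_all_iff.2 fun k => hX.ae_mass_eq hmass _
    have hl : ∀ᵐ ω ∂P, ∀ k : ℕ, minSize (X (k * h) ω) ≤ minSize (X (k * h + h) ω) :=
      ae_all_iff.2 fun k => hX.ae_minSize_le hmass _ _
    filter_upwards [hm, hl, hX.initial] with ω hm hl h0 hfar
    by_contra hcon
    have hcon1 : ω ∉ init := fun h => hcon (Or.inl h)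
    have hcon2 : ω ∉ mart := fun h => hcon (Or.inr h)
    obtain ⟨k, hk, hfar⟩ := hfar
    refine absurd hfar (not_lt.2 ?_)
    set Y : ℕ → Config := fun k => X (k * h) ω with hY
    have hto : ∀ k : ℕ, (toShell N (X (k * h) ω)).1 = Y k := fun k => toShell_coe (hm k)
    have herr : ∀ k ≤ M, ∑ j ∈ Finset.Iic R, |renorm N (Y k) j - renorm N (Y 0) j -
        r * ∑ l ∈ Finset.range k, genDrift K N (Y l) j| ≤ 2 * ε := by
      intro k hk
      have h1 : ∑ j ∈ Finset.Iic R, martPart Q (fun Z : Shell N => renorm N Z.1 j)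
          (fun k ω => toShell N (X (k * h) ω)) k ω ^ 2 < lam := by
        by_contra! hge
        exact hcon2 ⟨k, hk, hge⟩
      set m : ℕ+ → ℝ := fun j => martPart Q (fun Z : Shell N => renorm N Z.1 j)
        (fun k ω => toShell N (X (k * h) ω)) k ω with hmdef
      -- Cauchy-Schwarz over the `R` components
      have h2 : ∑ j ∈ Finset.Iic R, |m j| ≤ ε := by
        refine abs_le_of_sq_le_sq' ?_ hε.le |>.2
        refine sq_sum_le_card_mul_sum_sq.trans ?_
        rw [hcard]
        simp only [sq_abs]
        have h3 := mul_le_mul_of_nonneg_left h1.le hR0.le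
        rwa [hlam, mul_div_cancel₀ _ hR0.ne'] at h3
      have h3 : ∀ j ∈ Finset.Iic R, |renorm N (Y k) j - renorm N (Y 0) j -
          r * ∑ l ∈ Finset.range k, genDrift K N (Y l) j| ≤
          |m j| + k * (r * (ε / (T * (R : ℕ)))) := by
        intro j hj
        have h4 : renorm N (Y k) j - renorm N (Y 0) j -
            r * ∑ l ∈ Finset.range k, genDrift K N (Y l) j = m j +
            ∑ l ∈ Finset.range k, (meanIncr Q (fun Z : Shell N => renorm N Z.1 j)
              (toShell N (X (l * h) ω)) - r * genDrift K N (Y l) j) := by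
          rw [Finset.sum_sub_distrib, ← Finset.mul_sum]
          simp only [hmdef, martPart, hto]
          ring
        rw [h4]
        refine (abs_add_le _ _).trans (add_le_add le_rfl ?_)
        refine (Finset.abs_sum_le_sum_abs _ _).trans ?_
        have h5 : ∀ l ∈ Finset.range k, |meanIncr Q (fun Z : Shell N => renorm N Z.1 j)
            (toShell N (X (l * h) ω)) - r * genDrift K N (Y l) j| ≤ r * (ε / (T * (R : ℕ))) := by
          intro l _
          have h6 := hgen.1 j hj (toShell N (X (l * h) ω))
          rwa [hto] at h6
        refine (Finset.sum_le_sum h5).trans (le_of_eq ?_)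
        simp
      refine (Finset.sum_le_sum h3).trans ?_
      rw [Finset.sum_add_distrib, Finset.sum_const, nsmul_eq_mul, hcard]
      have h4 : (k : ℝ) * r ≤ T := by
        rw [← hM]
        exact mul_le_mul_of_nonneg_right (by exact_mod_cast hk) hr0.le
      have h5 : ((R : ℕ) : ℝ) * (k * (r * (ε / (T * (R : ℕ))))) = k * r / T * ε := by
        field_simp
      have h6 : k * r / T * ε ≤ ε := mul_le_of_le_one_left hε.le ((div_le_one hT).2 h4)
      rw [h5]
      linarith
    have happ := isApproxSolution_step hK ha.le hKa hN hNε hr0 hM hrε (Y := Y) (R := R)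
      (fun k _ => hm k) (fun k _ => by
        have := hl k
        simp only [hY]
        rwa [show ((k + 1 : ℕ) : ℝ≥0) * h = k * h + h by push_cast; ring]) herr
    have hY0 : Y 0 = X₀ ω := by simp [hY, h0]
    have hinit : ∑ j ∈ Finset.Iic R, |x 0 j - renorm N (Y ⌊(0 : ℝ) / r⌋₊) j| ≤ ε := by
      have hs : Summable fun k => |(renorm N (X₀ ω) - x₀) k| :=
        summable_abs_of_moment (summable_moment_sub (summable_moment_renorm N _) hx₀)
      have h1 : l1Norm (renorm N (X₀ ω) - x₀) ≤ ENNReal.ofReal ε := not_lt.1 hcon1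
      rw [l1Norm_eq hs, ENNReal.ofReal_le_ofReal_iff hε.le] at h1
      refine le_trans ?_ h1
      refine le_trans (le_of_eq ?_) (hs.sum_le_tsum (Finset.Iic R) fun _ _ => abs_nonneg _)
      refine Finset.sum_congr rfl fun j _ => ?_
      rw [zero_div, Nat.floor_zero, hY0, hx0, abs_sub_comm, Pi.sub_apply]
    have hkT : (k : ℝ) * r ∈ Set.Icc 0 T := by
      refine ⟨by positivity, ?_⟩
      rw [← hM]
      exact mul_le_mul_of_nonneg_right (by exact_mod_cast hk) hr0.le
    have hfin := hstab _ _ _ happ hinit _ hkT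
    have hfloor : ⌊(k : ℝ) * r / r⌋₊ = k := by
      rw [mul_div_cancel_right₀ _ hr0.ne', Nat.floor_natCast]
    have hcoe : ((k * h : ℝ≥0) : ℝ) = k * r := by
      push_cast
      rw [hhr]
    rw [hcoe]
    rwa [hfloor] at hfin
  have h1 : P.real (farOnGrid N X x (D * ε) h M) ≤ P.real (init ∪ mart) :=
    ENNReal.toReal_mono (measure_ne_top _ _) (measure_mono_ae hsub)
  refine h1.trans ((measureReal_union_le _ _).trans (add_le_add le_rfl (hmart.trans (le_of_eq ?_))))
  rw [← hM]
  ring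

/-- By right-continuity, a deviation from the solution at some time is visible on all fine dyadic
grids. -/
lemma exists_mem_farOnGrid {ω : Ω} (hx : IsSolution K x₀ τ ℓ x)
    (hrc : ∀ t, ∀ᶠ s in 𝓝[>] t, X s ω = X t ω) {T : ℝ≥0} (hT0 : 0 < T)
    (hT : ((T : ℝ) : EReal) < lifespan τ) {b : ℝ} {s : ℝ≥0} (hs : s ≤ T)
    (hfar : ENNReal.ofReal b < l1Norm (renorm N (X s ω) - x s)) :
    ∃ m : ℕ, ω ∈ farOnGrid N X x b (T / 2 ^ m) (2 ^ m) := by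
  have hsub := Icc_subset_lifeInterval hT
  have hconv : ∀ r : ℝ≥0, r ≤ T → ENNReal.ofReal b < l1Norm (renorm N (X r ω) - x r) →
      b < ∑' j, |(x r - renorm N (X r ω)) j| := by
    intro r hr hlt
    have hsum : Summable fun k => |(renorm N (X r ω) - x r) k| :=
      summable_abs_of_moment (summable_moment_sub (summable_moment_renorm N _)
        (hx.summable_moment (hsub ⟨r.2, hr⟩)))
    rw [l1Norm_eq hsum] at hlt
    refine (ENNReal.ofReal_lt_ofReal_iff'.1 hlt).1.trans_eq (tsum_congr fun k => ?_)
    rw [Pi.sub_apply, Pi.sub_apply, abs_sub_comm]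
  rcases hs.eq_or_lt with rfl | hsT
  · refine ⟨0, 1, by simp, ?_⟩
    simpa using hconv s le_rfl hfar
  set d := l1Norm (renorm N (X s ω) - x s) - ENNReal.ofReal b with hd
  have hd0 : 0 < d := tsub_pos_of_lt hfar
  have hev1 := hx.eventually_momentNorm_sub_lt (hsub ⟨s.2, hs⟩) hd0
  have hev2 : ∀ᶠ r : ℝ≥0 in 𝓝[>] s, momentNorm (x r - x s) < d := by
    have ht : Tendsto (fun r : ℝ≥0 => (r : ℝ)) (𝓝[>] s) (𝓝[lifeInterval τ] (s : ℝ)) := by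
      refine tendsto_nhdsWithin_iff.2
        ⟨(NNReal.continuous_coe.tendsto s).mono_left nhdsWithin_le_nhds, ?_⟩
      filter_upwards [Ioo_mem_nhdsGT hsT] with r hr
      exact hsub ⟨r.2, hr.2.le⟩
    exact ht.eventually hev1
  have hev : ∀ᶠ r : ℝ≥0 in 𝓝[>] s, b < ∑' j, |(x r - renorm N (X r ω)) j| := by
    filter_upwards [hev2, hrc s, Ioo_mem_nhdsGT hsT] with r h1 h2 h3
    refine hconv r h3.2.le ?_
    rw [h2]
    by_contra! hcon
    have h4 : l1Norm (renorm N (X s ω) - x s) ≤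
        l1Norm (renorm N (X s ω) - x r) + momentNorm (x r - x s) := by
      refine le_trans ?_ (add_le_add le_rfl (l1Norm_le_momentNorm _))
      rw [l1Norm, l1Norm, l1Norm, ← ENNReal.tsum_add]
      refine ENNReal.tsum_le_tsum fun k => ?_
      refine le_trans (le_of_eq ?_) (enorm_add_le _ _)
      congr 1
      simp
    have h5 := h4.trans_lt (ENNReal.add_lt_add_of_le_of_lt
      (ne_top_of_le_ne_top ENNReal.ofReal_ne_top hcon) hcon h1)
    rw [hd, add_tsub_cancel_of_le hfar.le] at h5
    exact lt_irrefl _ h5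
  -- the first point of a grid of mesh `δ` to the right of `s` lies in the good interval `(s, u)`
  obtain ⟨u, hu, hIoo⟩ := (mem_nhdsGT_iff_exists_Ioo_subset' hsT).1 hev
  have hu' : s < u := hu
  obtain ⟨m, hm⟩ := exists_nat_gt (T / (min u T - s))
  have hpos : 0 < min u T - s := tsub_pos_of_lt (lt_min hu' hsT)
  have h2m : (m : ℝ≥0) ≤ 2 ^ m := by exact_mod_cast Nat.lt_two_pow_self.le
  set δ := T / 2 ^ m with hδ
  have hδ0 : 0 < δ := by positivity
  have hδlt : δ < min u T - s := by
    rw [hδ, div_lt_iff₀ (by positivity)]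
    rw [div_lt_iff₀ hpos] at hm
    exact hm.trans_le (by rw [mul_comm]; gcongr)
  set k := ⌊s / δ⌋₊ + 1 with hk
  have hk1 : s < k * δ := by
    rw [← div_lt_iff₀ hδ0, hk]
    push_cast
    exact Nat.lt_floor_add_one _
  have hk2 : k * δ < min u T := by
    have h1 : (⌊s / δ⌋₊ : ℝ≥0) * δ ≤ s := by
      rw [← le_div_iff₀ hδ0]
      exact Nat.floor_le zero_le
    have h2 : (k : ℝ≥0) * δ = ⌊s / δ⌋₊ * δ + δ := by
      rw [hk]
      push_cast
      ring
    rw [h2]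
    calc ⌊s / δ⌋₊ * δ + δ < s + (min u T - s) := add_lt_add_of_le_of_lt h1 hδlt
      _ = min u T := add_tsub_cancel_of_le (lt_min hu' hsT).le
  refine ⟨m, k, ?_, hIoo ⟨hk1, hk2.trans_le (min_le_left _ _)⟩⟩
  have h1 : (k : ℝ≥0) * δ < 2 ^ m * δ := by
    rw [hδ, mul_div_cancel₀ _ (by positivity), ← hδ]
    exact hk2.trans_le (min_le_right _ _)
  have h2 := lt_of_mul_lt_mul_right h1 zero_le
  exact_mod_cast h2.le

lemma monotone_farOnGrid (N : ℕ) (X : ℝ≥0 → Ω → Config) (x : ℝ → ℕ+ → ℝ) (b : ℝ) (T : ℝ≥0) :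
    Monotone fun m : ℕ => farOnGrid N X x b (T / 2 ^ m) (2 ^ m) := by
  refine monotone_nat_of_le_succ fun m => ?_
  rintro ω ⟨k, hk, hfar⟩
  refine ⟨2 * k, by rw [pow_succ]; omega, ?_⟩
  have h1 : ((2 * k : ℕ) : ℝ≥0) * (T / 2 ^ (m + 1)) = k * (T / 2 ^ m) := by
    push_cast
    rw [pow_succ]
    field_simp
  rw [h1]
  exact hfar

end GridEvent

lemma HasMinBound.exists_linear_bound {K : ℕ+ → ℕ+ → ℝ} (hK : HasMinBound K) :
    ∃ a : ℝ, 0 < a ∧ ∀ i j : ℕ+, i ≤ j → K i j ≤ a * (i : ℕ) := by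
  obtain ⟨κ, hκ0, hκ, A, hA⟩ := hK
  have hi0 : ∀ i : ℕ+, (0 : ℝ) < (i : ℕ) := fun i => by exact_mod_cast i.pos
  have h1 : ∀ i : ℕ+, κ i / (i : ℕ) ≤ A := fun i => hA ⟨i, rfl⟩
  refine ⟨A, (div_pos (hκ0 1) (hi0 1)).trans_le (h1 1), fun i j hij => (hκ i j hij).trans ?_⟩
  rw [← div_le_iff₀ (hi0 i)]
  exact h1 i

end MinDriven

theorem theorem1p4 (K : ℕ+ → ℕ+ → ℝ) (hK : MinDriven.IsCoagulationKernel K)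
    (hKmin : MinDriven.HasMinBound K)
    (x₀ : ℕ+ → ℝ) (hx₀ : x₀ ∈ MinDriven.XCone 1) (hx₀_one : 0 < x₀ 1)
    (hx₀_norm : MinDriven.momentNorm x₀ = 1)
    (τ : ℕ → ℝ) (ℓ : ℝ → ℕ+) (x : ℝ → ℕ+ → ℝ) (hx : MinDriven.IsSolution K x₀ τ ℓ x)
    {Ω : ℕ → Type*} [∀ N, MeasurableSpace (Ω N)]
    (P : ∀ N, Measure (Ω N)) [∀ N, IsProbabilityMeasure (P N)]
    (X₀ : ∀ N, Ω N → MinDriven.Config)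
    (hX₀_meas : ∀ N, 1 ≤ N → Measurable (X₀ N))
    (hX₀_mass : ∀ N, 1 ≤ N → ∀ᵐ ω ∂P N, MinDriven.mass (X₀ N ω) = N)
    (hX₀_close : ∀ N, 1 ≤ N →
      (P N).real {ω | ENNReal.ofReal (1 / (N : ℝ) ^ (1 / 4 : ℝ)) <
        MinDriven.l1Norm (MinDriven.renorm N (X₀ N ω) - x₀)} ≤ 1 / (N : ℝ) ^ (1 / 4 : ℝ))
    (X : ∀ N, ℝ≥0 → Ω N → MinDriven.Config)
    (hX : ∀ N, 1 ≤ N → MinDriven.IsMinDrivenProcess (P N) K (X₀ N) (X N)) :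
    ∀ t : ℝ, 0 < t → (t : EReal) < MinDriven.lifespan τ →
      ∃ C D : ℝ, 0 < C ∧ 0 < D ∧ ∀ᶠ N : ℕ in atTop,
        (P N).real {ω | ENNReal.ofReal (D / (N : ℝ) ^ (1 / 4 : ℝ)) ≤
          ⨆ s : ℝ≥0, ⨆ _ : (s : ℝ) ≤ t,
            MinDriven.l1Norm (MinDriven.renorm N (X N s ω) - x s)} ≤
          C / (N : ℝ) ^ (1 / 4 : ℝ) := by
  intro t ht0 ht
  lift t to ℝ≥0 using ht0.le with T
  obtain ⟨a, ha, hKa⟩ := hKmin.exists_linear_bound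
  obtain ⟨D, ε₀, hD, hε₀, hstab⟩ := hx.stability hK ha hKa ht0.le ht
  refine ⟨1 + 20 * a * T, 2 * D, by positivity, by positivity, ?_⟩
  have hlim : Tendsto (fun N : ℕ => 1 / (N : ℝ) ^ (1 / 4 : ℝ)) atTop (𝓝 0) :=
    tendsto_const_nhds.div_atTop
      ((tendsto_rpow_atTop (by norm_num)).comp tendsto_natCast_atTop_atTop)
  filter_upwards [eventually_ge_atTop 1, hlim.eventually_le_const hε₀] with N hN hε1
  have hN0 : N ≠ 0 := by omega
  have hNpos : (0 : ℝ) < N := by exact_mod_cast hN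
  set w : ℝ := (N : ℝ) ^ (1 / 4 : ℝ) with hw
  have hw1 : 1 ≤ w := Real.one_le_rpow (by exact_mod_cast hN) (by norm_num)
  have hw0 : 0 < w := by linarith
  have hw4 : w ^ 4 = N := by
    rw [hw, ← Real.rpow_natCast, ← Real.rpow_mul hNpos.le]
    norm_num
  set ε : ℝ := 1 / w with hε
  have hεpos : 0 < ε := by positivity
  have hNε : 1 / (N : ℝ) ≤ ε := by
    rw [← hw4]
    exact one_div_le_one_div_of_le hw0 (le_self_pow₀ hw1 (by norm_num))
  -- the number of components which are followed individually
  set R : ℕ+ := ⟨⌈w⌉₊, Nat.ceil_pos.2 hw0⟩ with hR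
  have hRw : w ≤ (R : ℕ) := Nat.le_ceil w
  have hRw' : ((R : ℕ) : ℝ) ≤ 2 * w := (Nat.ceil_lt_add_one hw0.le).le.trans (by linarith)
  have hRε : 1 / ((R : ℕ) : ℝ) ≤ ε := one_div_le_one_div_of_le hw0 hRw
  have hx₀s : Summable fun k : ℕ+ => ((k : ℕ) : ℝ) * |x₀ k| := MinDriven.summable_moment hx₀.1.1.ne
  have hgrid := MinDriven.eventually_measureReal_farOnGrid_le (hX N hN) (hX₀_mass N hN) hK ha
    hKa hN0 hNε ht0 hεpos hx.initial hx₀s fun q y β => hstab ε R q y β hεpos hε1 hRε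
  have hdyad : Tendsto (fun m : ℕ => (T : ℝ) / 2 ^ m) atTop (𝓝[>] 0) := by
    refine tendsto_nhdsWithin_iff.2 ⟨tendsto_const_nhds.div_atTop
      (tendsto_pow_atTop_atTop_of_one_lt one_lt_two), Eventually.of_forall fun m => ?_⟩
    exact div_pos ht0 (by positivity)
  have hfluct : (T : ℝ) * (10 * a / N) / (ε ^ 2 / (R : ℕ)) ≤ 20 * a * T * ε := by
    have h1 : (T : ℝ) * (10 * a / N) / (ε ^ 2 / (R : ℕ)) = 10 * a * T * (R : ℕ) / w ^ 2 := by
      rw [hε, ← hw4]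
      field_simp
    rw [h1, hε, mul_one_div, div_le_div_iff₀ (by positivity) hw0]
    have h2 : 0 ≤ a * T * w := by positivity
    nlinarith [mul_le_mul_of_nonneg_left hRw' h2]
  have hbound : ∀ᶠ m : ℕ in atTop,
      (P N).real (MinDriven.farOnGrid N (X N) x (D * ε) (T / 2 ^ m) (2 ^ m)) ≤
        (1 + 20 * a * T) * ε := by
    filter_upwards [hdyad.eventually hgrid] with m hm
    refine (hm (T / 2 ^ m) (2 ^ m) (by push_cast; rfl) ?_).trans ?_
    · push_cast
      exact mul_div_cancel₀ _ (by positivity)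
    · linarith [hX₀_close N hN]
  have hunion : (P N).real (⋃ m : ℕ, MinDriven.farOnGrid N (X N) x (D * ε) (T / 2 ^ m) (2 ^ m)) ≤
      (1 + 20 * a * T) * ε := by
    refine le_of_tendsto ?_ hbound
    exact (ENNReal.tendsto_toReal (measure_ne_top _ _)).comp
      (tendsto_measure_iUnion_atTop (MinDriven.monotone_farOnGrid N (X N) x (D * ε) T))
  rw [div_eq_mul_one_div (1 + 20 * a * (T : ℝ)), ← hε]
  refine le_trans (ENNReal.toReal_mono (measure_ne_top _ _) (measure_mono_ae ?_)) hunion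
  filter_upwards [(hX N hN).rightContinuous] with ω hrc hω
  have hlt : ENNReal.ofReal (D * ε) < ENNReal.ofReal (2 * D / w) := by
    refine (ENNReal.ofReal_lt_ofReal_iff (by positivity)).2 ?_
    rw [hε, mul_one_div]
    gcongr
    linarith
  obtain ⟨s, hs⟩ := lt_iSup_iff.1 (hlt.trans_le hω)
  obtain ⟨hsT, hs⟩ := lt_iSup_iff.1 hs
  exact Set.mem_iUnion.2
    (MinDriven.exists_mem_farOnGrid hx hrc (by exact_mod_cast ht0) ht (by exact_mod_cast hsT) hs)
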